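/- **Conventions.** Let $p$ be a prime. Subgroups of profinite groups are closed and homomorphisms between them are continuous; "$p$-subgroup" and "Sylow $p$-subgroup" of a profinite group mean pro-$p$ subgroup and Sylow pro-$p$ subgroup. For subgroups $X,Q\le S$, $\mathrm{Aut}_X(Q)$ is the image of $N_X(Q)$ in the automorphism group of $Q$ under conjugation. **Pro-fusion systems.** A *fusion system* on a finite $p$-group $S$ is a category whose objects are the subgroups of $S$ and whose morphisms are injective group homomorphisms, which contains every homomorphism $P\to Q$ induced by conjugation by an element of $S$ and in which every morphism is an isomorphism of the category followed by an inclusion. A *morphism* $\mathcal F\to\mathcal G$ of fusion systems on $S$ and $S'$ is a homomorphism $\alpha:S\to S'$ for which there is a functor $A:\mathcal F\to\mathcal G$ with $A(P)=\alpha(P)$ for all $P\le S$ and $\alpha\varphi=A(\varphi)\alpha$ for all morphisms $\varphi$ of $\mathcal F$. Given an inverse system, over a directed set $I$, of fusion systems $\mathcal F_i$ on finite $p$-groups $S_i$, let $S=\varprojlim S_i$ with projections $f_i:S\to S_i$. The *pro-fusion system* $\mathcal F=\varprojlim\mathcal F_i$ on the pro-$p$ group $S$ is the category whose objects are the closed subgroups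 of $S$, with $\mathrm{Hom}_{\mathcal F}(P,Q)=\varprojlim \mathrm{Hom}_{\mathcal F_i}(f_i(P),f_i(Q))$, a profinite set of homomorphisms $P\to Q$. A closed subgroup $T\le S$ is *strongly $\mathcal F$-closed* if $\varphi(R)\le T$ for all $R\le T$ and all $\varphi\in\mathrm{Hom}_{\mathcal F}(R,S)$. **$T$-subsystems.** Let $T$ be strongly $\mathcal F$-closed. A *$T$-subsystem* $\mathcal E$ of $\mathcal F$ is a subcategory on the same objects such that every $\mathrm{Hom}_{\mathcal E}(P,Q)$ is closed in $\mathrm{Hom}_{\mathcal F}(P,Q)$ and 1. $\mathcal E$ contains every homomorphism $P\to Q$ induced by conjugation by an element of $T$; 2. every morphism of $\mathcal E$ is an isomorphism of $\mathcal E$ followed by an inclusion; 3. $\varphi|_{P'}\,\mathrm{Hom}_{\mathcal E}(P,P')=\mathrm{Hom}_{\mathcal E}(\varphi(P),\varphi(P'))\,\varphi|_P$ for all $P,P'\le Q\le S$ and $\varphi\in\mathrm{Hom}_{\mathcal F}(Q,S)$; 4. $\psi(u)u^{-1}\in T$ for all $Q\le S$, $\psi\in\mathrm{Hom}_{\mathcal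 E}(Q,S)$ and $u\in Q$. **Saturation.** A subgroup $Q\le S$ is *receptive in $\mathcal E$* if for all $R\le S$ every $\varphi\in\mathrm{Iso}_{\mathcal E}(R,Q)$ extends to a morphism $N^T_\varphi\to N_T(Q)Q$ of $\mathcal E$, where $$N^T_\varphi=\{x\in N_T(R)R \mid \exists\, y\in N_T(Q)Q,\ \forall u\in R,\ \varphi(xux^{-1})=y\varphi(u)y^{-1}\}.$$ It is *fully normalized in $\mathcal E$* if it is receptive in $\mathcal E$ and $\mathrm{Aut}_T(Q)$ is a Sylow $p$-subgroup of the profinite group $\mathrm{Aut}_{\mathcal E}(Q)$. The $T$-subsystem $\mathcal E$ is *saturated* if every $\mathcal E$-isomorphism class of closed subgroups of $S$ contains a subgroup that is fully normalized in $\mathcal E$. **Essential subgroups.** $Q$ is *$\mathcal E$-centric* if $C_T(Q')\le Z(Q')$ for all $Q'$ in the $\mathcal E$-isomorphism class of $Q$. For a profinite group $G$ let $\mathcal S_p(G)$ be the poset of non-trivial $p$-subgroups of $G$. $Q$ is *$\mathcal E$-essential* if $T\le Q$, or if $Q$ is $\mathcal E$-centric and $\mathcal S_p\big(\mathrm{Aut}_{\mathcal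 E}(Q)/\mathrm{Aut}_{T\cap Q}(Q)\big)$ is disconnected or empty. **Theorem.** Let $\mathcal F$ be a pro-fusion system on $S$, let $T$ be a strongly $\mathcal F$-closed subgroup of $S$ and let $\mathcal E$ be a saturated $T$-subsystem of $\mathcal F$. Let $P$ and $P'$ be open subgroups of $S$ and let $\varphi\in\mathrm{Iso}_{\mathcal E}(P,P')$. Then there are an integer $n\ge 0$, open subgroups $P=P_0,P_1,\dots,P_n=P'$ and $Q_1,\dots,Q_n$ of $S$, and automorphisms $\varphi_i\in\mathrm{Aut}_{\mathcal E}(Q_i)$ for $1\le i\le n$, such that (a) each $Q_i$ is $\mathcal E$-essential and fully normalized in $\mathcal E$; (b) $P_{i-1},P_i\le Q_i$ and $\varphi_i(P_{i-1})=P_i$ for each $i$; (c) $\varphi(u)=\varphi_n\cdots\varphi_2\varphi_1(u)$ for all $u\in P$. -/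

import Mathlib

universe u v w

/-- The homomorphism `P → Q`, `x ↦ s x s⁻¹`, where `s P s⁻¹ ≤ Q`. -/
def conjHom {S A : Type*} [Group S] [SetLike A S] [SubgroupClass A S] (s : S) (P Q : A)
    (h : ∀ x ∈ P, s * x * s⁻¹ ∈ Q) : P →* Q where
  toFun x := ⟨s * x * s⁻¹, h x x.2⟩
  map_one' := by ext; simp
  map_mul' x y := by ext; simp

/-- The inclusion homomorphism `P → Q`, where `P ≤ Q`. -/
def inclHom {S A : Type*} [Group S] [SetLike A S] [SubgroupClass A S] (P Q : A)
    (h : ∀ x ∈ P, x ∈ Q) : P →* Q where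
  toFun x := ⟨x, h x x.2⟩
  map_one' := by ext; simp
  map_mul' x y := by ext; simp

/-! ### Fusion systems on finite groups and their morphisms -/

/-- A fusion system on the group `S` (which will be a finite `p`-group): a category whose objects
are the subgroups of `S` and whose morphisms are injective group homomorphisms, which contains the
homomorphisms induced by conjugation in `S`, and in which every morphism is an isomorphism
followed by an inclusion. -/
structure FusionSystem (S : Type w) [Group S] where
  Hom : (P Q : Subgroup S) → Set (P →* Q)
  injective : ∀ {P Q : Subgroup S} {φ : P →* Q}, φ ∈ Hom P Q → Function.Injective φ
  id_mem : ∀ P : Subgroup S, MonoidHom.id P ∈ Hom P P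
  comp_mem : ∀ {P Q R : Subgroup S} {ψ : Q →* R} {φ : P →* Q},
    ψ ∈ Hom Q R → φ ∈ Hom P Q → ψ.comp φ ∈ Hom P R
  conj_mem : ∀ (s : S) (P Q : Subgroup S) (h : ∀ x ∈ P, s * x * s⁻¹ ∈ Q),
    conjHom s P Q h ∈ Hom P Q
  factor : ∀ {P Q : Subgroup S} {φ : P →* Q}, φ ∈ Hom P Q →
    ∃ (R : Subgroup S) (h : ∀ x ∈ R, x ∈ Q) (θ : P ≃* R),
      θ.toMonoidHom ∈ Hom P R ∧ θ.symm.toMonoidHom ∈ Hom R P ∧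
        φ = (inclHom R Q h).comp θ.toMonoidHom

/-- The relation `α ∘ φ = ψ ∘ α` for `φ : P → Q` and `ψ : α(P) → α(Q)`. For given `α` and `φ` there
is at most one such `ψ`. -/
def FusionSystem.Induces {S S' : Type*} [Group S] [Group S'] {P Q : Subgroup S} (α : S →* S')
    (φ : P →* Q) (ψ : P.map α →* Q.map α) : Prop :=
  ∀ x : P, ((ψ ⟨α x, Subgroup.mem_map_of_mem α x.2⟩ : Q.map α) : S') = α (φ x)

/-- The group homomorphism `α` is a morphism of fusion systems from `F` to `F'`: there is a functor
`A` from `F` to `F'` with `A(P) = α(P)` on objects and `α φ = A(φ) α` on morphisms. As `A(φ)` is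
determined by `α` and `φ`, functoriality is automatic. -/
def FusionSystem.IsMorphism {S S' : Type*} [Group S] [Group S'] (F : FusionSystem S)
    (F' : FusionSystem S') (α : S →* S') : Prop :=
  ∀ (P Q : Subgroup S), ∀ φ ∈ F.Hom P Q, ∃ ψ ∈ F'.Hom (P.map α) (Q.map α),
    FusionSystem.Induces α φ ψ

/-! ### Inverse systems and pro-fusion systems -/

/-- An inverse system of fusion systems on finite (discrete) `p`-groups, over a directed set. -/
structure FusionInverseSystem (p : ℕ) where
  I : Type v
  [order : PartialOrder I]
  [directed : IsDirectedOrder I]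
  [nonempty : Nonempty I]
  S : I → Type w
  [group : ∀ i, Group (S i)]
  [finite : ∀ i, Finite (S i)]
  [topology : ∀ i, TopologicalSpace (S i)]
  [discrete : ∀ i, DiscreteTopology (S i)]
  isPGroup : ∀ i, IsPGroup p (S i)
  fusion : ∀ i, FusionSystem (S i)
  map : ∀ {i j : I}, i ≤ j → (S j →* S i)
  map_refl : ∀ i, map (le_refl i) = MonoidHom.id (S i)
  map_comp : ∀ {i j k : I} (hij : i ≤ j) (hjk : j ≤ k),
    (map hij).comp (map hjk) = map (hij.trans hjk)
  isMorphism : ∀ {i j : I} (hij : i ≤ j), (fusion j).IsMorphism (fusion i) (map hij)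

attribute [instance] FusionInverseSystem.order FusionInverseSystem.directed
  FusionInverseSystem.nonempty FusionInverseSystem.group FusionInverseSystem.finite
  FusionInverseSystem.topology FusionInverseSystem.discrete

/-- The inverse limit of the groups `S i`, as a subgroup of the product; it carries the subspace
topology of the product topology. -/
def FusionInverseSystem.limit {p : ℕ} (D : FusionInverseSystem.{v, w} p) :
    Subgroup (∀ i, D.S i) where
  carrier := {x | ∀ (i j : D.I) (h : i ≤ j), D.map h (x j) = x i}
  one_mem' := by intro i j h; simp
  mul_mem' := by intro a b ha hb i j h; simp [ha i j h, hb i j h]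
  inv_mem' := by intro a ha i j h; simp [ha i j h]

/-- A pro-fusion system on the topological group `S`: `S` is identified with the inverse limit of
the groups of an inverse system of fusion systems on finite `p`-groups. The morphisms are given by
`ProFusionSystem.Hom`. -/
structure ProFusionSystem (p : ℕ) (S : Type u) [Group S] [TopologicalSpace S] where
  sys : FusionInverseSystem.{v, w} p
  iso : S ≃ₜ* sys.limit

/-- A set of homomorphisms `P → Q` for any two closed subgroups `P` and `Q` of `S`. -/
abbrev HomFamily (S : Type u) [Group S] [TopologicalSpace S] : Type u :=
  (P Q : ClosedSubgroup S) → Set (P →* Q)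

/-- `θ` is an isomorphism of the category with morphisms `H`. -/
def HomFamily.IsIso {S : Type u} [Group S] [TopologicalSpace S] (H : HomFamily S)
    {P Q : ClosedSubgroup S} (θ : P ≃* Q) : Prop :=
  θ.toMonoidHom ∈ H P Q ∧ θ.symm.toMonoidHom ∈ H Q P

/-- `S` as a closed subgroup of itself. -/
def wholeGroup (S : Type u) [Group S] [TopologicalSpace S] : ClosedSubgroup S :=
  ⟨⊤, isClosed_univ⟩

namespace ProFusionSystem

section

variable {p : ℕ} {S : Type u} [Group S] [TopologicalSpace S] (F : ProFusionSystem.{u, v, w} p S)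

/-- The projection `f_i : S → S_i`. -/
def proj (i : F.sys.I) : S →* F.sys.S i :=
  (Pi.evalMonoidHom F.sys.S i).comp (F.sys.limit.subtype.comp F.iso.toMulEquiv.toMonoidHom)

/-- `Hom_F(P, Q)`, the inverse limit of the sets `Hom_{F_i}(f_i(P), f_i(Q))`: a compatible family
`(φ_i)` is identified with the homomorphism `φ : P → Q` such that `f_i φ = φ_i f_i` for all `i`. -/
def Hom : HomFamily S := fun P Q =>
  {φ | ∀ i, ∃ ψ ∈ (F.sys.fusion i).Hom (P.toSubgroup.map (F.proj i)) (Q.toSubgroup.map (F.proj i)),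
    FusionSystem.Induces (P := P.toSubgroup) (Q := Q.toSubgroup) (F.proj i) φ ψ}

/-- The topology of `Hom_F(P, Q)` as an inverse limit of discrete sets: the component `φ_i` of `φ`
is recorded by the function `f_i φ = φ_i f_i` on `P`. -/
instance homTopology (P Q : ClosedSubgroup S) : TopologicalSpace (F.Hom P Q) :=
  ⨅ i, TopologicalSpace.induced
    (fun (φ : F.Hom P Q) (x : P) => F.proj i (φ.1 x : Q)) (⊥ : TopologicalSpace (P → F.sys.S i))

/-- The closed subgroup `T` is strongly `F`-closed. -/
def StronglyClosed (T : ClosedSubgroup S) : Prop :=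
  ∀ (R : ClosedSubgroup S), ∀ φ ∈ F.Hom R (wholeGroup S), R ≤ T → ∀ x : R, (φ x : S) ∈ T

theorem continuous_proj (i : F.sys.I) : Continuous (F.proj i) :=
  (continuous_apply i).comp (continuous_subtype_val.comp F.iso.continuous)

theorem continuous_of_mem {P Q : ClosedSubgroup S} {φ : P →* Q} (hφ : φ ∈ F.Hom P Q) :
    Continuous φ := by
  refine Continuous.subtype_mk (f := fun x => ((φ x : Q) : S)) ?_ _
  have hi : Topology.IsInducing F.iso := F.iso.toHomeomorph.isInducing
  rw [hi.continuous_iff]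
  refine Continuous.subtype_mk (continuous_pi fun i => ?_) _
  obtain ⟨ψ, -, h⟩ := hφ i
  have key : (fun x : P => F.proj i (φ x : Q)) = fun x : P =>
      ((ψ ⟨F.proj i x, Subgroup.mem_map_of_mem (F.proj i) x.2⟩ :
        Q.toSubgroup.map (F.proj i)) : F.sys.S i) := by
    funext x
    exact (h x).symm
  change Continuous (fun x : P => F.proj i (φ x : Q))
  rw [key]
  refine continuous_subtype_val.comp ((continuous_of_discreteTopology (f := ψ)).comp ?_)
  exact ((F.continuous_proj i).comp continuous_subtype_val).subtype_mk _

/-- The image `φ(P)` of a closed subgroup `P ≤ Q` under a morphism `φ : Q → R` of `F`. -/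
def image [CompactSpace S] [T2Space S] {Q R : ClosedSubgroup S} (φ : Q →* R) (hφ : φ ∈ F.Hom Q R)
    (P : ClosedSubgroup S) (hP : P ≤ Q) : ClosedSubgroup S where
  carrier := {y | ∃ x : P, (φ ⟨x, hP x.2⟩ : S) = y}
  one_mem' := ⟨1, by
    have : (⟨((1 : P) : S), hP (1 : P).2⟩ : Q) = 1 := rfl
    rw [this, map_one]; rfl⟩
  mul_mem' := by
    rintro _ _ ⟨x, rfl⟩ ⟨y, rfl⟩
    refine ⟨x * y, ?_⟩
    have : (⟨((x * y : P) : S), hP (x * y).2⟩ : Q) = ⟨x, hP x.2⟩ * ⟨y, hP y.2⟩ := rfl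
    rw [this, map_mul]; rfl
  inv_mem' := by
    rintro _ ⟨x, rfl⟩
    refine ⟨x⁻¹, ?_⟩
    have : (⟨((x⁻¹ : P) : S), hP (x⁻¹).2⟩ : Q) = ⟨x, hP x.2⟩⁻¹ := rfl
    rw [this, map_inv]; rfl
  isClosed' := by
    have hc : Continuous (fun x : P => ((φ ⟨x, hP x.2⟩ : R) : S)) :=
      continuous_subtype_val.comp ((F.continuous_of_mem hφ).comp
        (continuous_subtype_val.subtype_mk _))
    exact (isCompact_range hc).isClosed

end

end ProFusionSystem

/-! ### `T`-subsystems -/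

/-- A `T`-subsystem `E` of the pro-fusion system `F`. -/
structure TSubsystem {p : ℕ} {S : Type u} [Group S] [TopologicalSpace S] [CompactSpace S]
    [T2Space S] (F : ProFusionSystem.{u, v, w} p S) (T : ClosedSubgroup S) where
  Hom : HomFamily S
  subset : ∀ P Q : ClosedSubgroup S, Hom P Q ⊆ F.Hom P Q
  id_mem : ∀ P : ClosedSubgroup S, MonoidHom.id P ∈ Hom P P
  comp_mem : ∀ {P Q R : ClosedSubgroup S} {ψ : Q →* R} {φ : P →* Q},
    ψ ∈ Hom Q R → φ ∈ Hom P Q → ψ.comp φ ∈ Hom P R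
  conj_mem : ∀ t ∈ T, ∀ (P Q : ClosedSubgroup S) (h : ∀ x ∈ P, t * x * t⁻¹ ∈ Q),
    conjHom t P Q h ∈ Hom P Q
  factor : ∀ {P Q : ClosedSubgroup S} {φ : P →* Q}, φ ∈ Hom P Q →
    ∃ (R : ClosedSubgroup S) (h : ∀ x ∈ R, x ∈ Q) (θ : P ≃* R),
      HomFamily.IsIso Hom θ ∧ φ = (inclHom R Q h).comp θ.toMonoidHom
  /-- `φ|_{P'} Hom_E(P, P') = Hom_E(φ(P), φ(P')) φ|_P` for `P, P' ≤ Q` and `φ ∈ Hom_F(Q, S)`. -/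
  invariant : ∀ (Q P P' : ClosedSubgroup S) (hP : P ≤ Q) (hP' : P' ≤ Q)
    (φ : Q →* wholeGroup S) (hφ : φ ∈ F.Hom Q (wholeGroup S)),
    {g : P → S | ∃ α ∈ Hom P P', ∀ x : P, g x = φ ⟨α x, hP' (α x).2⟩} =
    {g : P → S | ∃ β ∈ Hom (F.image φ hφ P hP) (F.image φ hφ P' hP'),
      ∀ x : P, g x = β ⟨φ ⟨x, hP x.2⟩, ⟨x, rfl⟩⟩}
  trivial_mod : ∀ (Q : ClosedSubgroup S), ∀ ψ ∈ Hom Q (wholeGroup S),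
    ∀ x : Q, (ψ x : S) * (x : S)⁻¹ ∈ T
  isClosed : ∀ P Q : ClosedSubgroup S, IsClosed {φ : F.Hom P Q | φ.1 ∈ Hom P Q}

/-! ### Groups of automorphisms -/

/-- `Aut_X(Q)`, the image of `N_X(Q)` in the group of automorphisms of `Q`. -/
def conjAut {S : Type u} [Group S] [TopologicalSpace S] (X : Subgroup S) (Q : ClosedSubgroup S) :
    Subgroup (MulAut Q) where
  carrier := {α | ∃ t ∈ X ⊓ Subgroup.normalizer (Q : Set S), ∀ x : Q, (α x : S) = t * x * t⁻¹}
  one_mem' := ⟨1, one_mem _, by simp⟩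
  mul_mem' := by
    rintro α β ⟨t, ht, hα⟩ ⟨s, hs, hβ⟩
    exact ⟨t * s, mul_mem ht hs, fun x => by simp [hα, hβ, mul_assoc]⟩
  inv_mem' := by
    rintro α ⟨t, ht, hα⟩
    refine ⟨t⁻¹, inv_mem ht, fun x => ?_⟩
    have h := hα (α⁻¹ x)
    rw [MulAut.apply_inv_self] at h
    rw [h]
    group

/-- `N_T(Q) Q`. -/
def normMul {S : Type u} [Group S] [TopologicalSpace S] [IsTopologicalGroup S] [CompactSpace S]
    [T2Space S] (T Q : ClosedSubgroup S) : ClosedSubgroup S where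
  toSubgroup := (T.toSubgroup ⊓ Subgroup.normalizer (Q : Set S)) ⊔ Q.toSubgroup
  isClosed' := by
    have hN : IsClosed ((Subgroup.normalizer (Q : Set S) : Subgroup S) : Set S) := by
      have : ((Subgroup.normalizer (Q : Set S) : Subgroup S) : Set S) =
          (⋂ x : Q, {g : S | g * x * g⁻¹ ∈ (Q : Set S)}) ∩
            ⋂ x : Q, {g : S | g⁻¹ * x * g ∈ (Q : Set S)} := by
        ext g
        simp only [SetLike.mem_coe, Set.mem_inter_iff, Set.mem_iInter,
          Set.mem_ofPred_eq]
        constructor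
        · intro h
          refine ⟨fun x => (h x).1 x.2, fun x => (h _).2 ?_⟩
          have : g * (g⁻¹ * x * g) * g⁻¹ = (x : S) := by group
          rw [this]; exact x.2
        · rintro ⟨h1, h2⟩ n
          refine ⟨fun hn => h1 ⟨n, hn⟩, fun hn => ?_⟩
          have h3 := h2 ⟨_, hn⟩
          have e : g⁻¹ * (g * n * g⁻¹) * g = n := by group
          rw [← e]
          exact h3
      rw [this]
      have hQ : IsClosed (Q : Set S) := Q.isClosed'
      exact (isClosed_iInter fun x => hQ.preimage (by fun_prop)).inter
        (isClosed_iInter fun x => hQ.preimage (by fun_prop))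
    have hle : T.toSubgroup ⊓ Subgroup.normalizer (Q : Set S) ≤
        Subgroup.normalizer (Q.toSubgroup : Set S) := inf_le_right
    change IsClosed (((T.toSubgroup ⊓ Subgroup.normalizer (Q : Set S)) ⊔ Q.toSubgroup :
      Subgroup S) : Set S)
    rw [Subgroup.coe_mul_of_left_le_normalizer_right _ _ hle]
    have hA : IsClosed ((T.toSubgroup ⊓ Subgroup.normalizer (Q : Set S) : Subgroup S) : Set S) :=
      T.isClosed'.inter hN
    exact (hA.isCompact.mul Q.isClosed'.isCompact).isClosed

theorem normMul_conj_mem {S : Type u} [Group S] [TopologicalSpace S] [IsTopologicalGroup S]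
    [CompactSpace S] [T2Space S] {T Q : ClosedSubgroup S} {x : S} (hx : x ∈ normMul T Q) {u : S}
    (hu : u ∈ Q) : x * u * x⁻¹ ∈ Q := by
  have hle : (normMul T Q).toSubgroup ≤ Subgroup.normalizer (Q : Set S) :=
    sup_le inf_le_right (Subgroup.le_normalizer (H := Q.toSubgroup))
  exact (Subgroup.mem_normalizer_iff.1 (hle hx) u).1 hu

namespace TSubsystem

section

variable {p : ℕ} {S : Type u} [Group S] [TopologicalSpace S] [IsTopologicalGroup S]
  [CompactSpace S] [T2Space S] {F : ProFusionSystem.{u, v, w} p S} {T : ClosedSubgroup S}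
  (E : TSubsystem F T)

/-- `Aut_E(Q)`. -/
def aut (Q : ClosedSubgroup S) : Subgroup (MulAut Q) where
  carrier := {α | HomFamily.IsIso E.Hom α}
  one_mem' := ⟨E.id_mem Q, E.id_mem Q⟩
  mul_mem' := fun ha hb => ⟨E.comp_mem ha.1 hb.1, E.comp_mem hb.2 ha.2⟩
  inv_mem' := fun ha => ⟨ha.2, ha.1⟩

/-- An element of `Aut_E(Q)` as an element of `Hom_F(Q, Q)`. -/
def autToHom (Q : ClosedSubgroup S) (α : E.aut Q) : F.Hom Q Q :=
  ⟨α.1.toMonoidHom, E.subset Q Q α.2.1⟩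

/-- The topology of the profinite group `Aut_E(Q)`, induced from `Hom_F(Q, Q)`. -/
instance autTopology (Q : ClosedSubgroup S) : TopologicalSpace (E.aut Q) :=
  TopologicalSpace.induced (E.autToHom Q) inferInstance

/-- `Aut_X(Q)` as a subgroup of `Aut_E(Q)`, for `X ≤ T`. -/
def innerAut (X : Subgroup S) (Q : ClosedSubgroup S) : Subgroup (E.aut Q) :=
  (conjAut X Q).subgroupOf (E.aut Q)

theorem conjAut_le_aut (Q : ClosedSubgroup S) : conjAut T.toSubgroup Q ≤ E.aut Q := by
  have key : ∀ α ∈ conjAut T.toSubgroup Q, MulEquiv.toMonoidHom α ∈ E.Hom Q Q := by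
    rintro α ⟨t, ht, h⟩
    have h' : ∀ x ∈ Q, t * x * t⁻¹ ∈ Q := fun x hx =>
      (Subgroup.mem_normalizer_iff.1 ht.2 x).1 hx
    have e : MulEquiv.toMonoidHom α = conjHom t Q Q h' := by
      ext x
      exact h x
    rw [e]
    exact E.conj_mem t ht.1 Q Q h'
  exact fun α hα => ⟨key α hα, key α⁻¹ (inv_mem hα)⟩

/-- `Aut_{T ∩ Q}(Q)` is normal in `Aut_E(Q)`. -/
instance innerAut_normal (Q : ClosedSubgroup S) :
    (E.innerAut (T.toSubgroup ⊓ Q.toSubgroup) Q).Normal where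
  conj_mem := by
    rintro ⟨γ, hγ⟩ ⟨t, ⟨⟨htT, htQ⟩, -⟩, ht⟩ ⟨α, hα⟩
    have hin : (inclHom Q (wholeGroup S) fun _ _ => trivial).comp (MulEquiv.toMonoidHom α) ∈
        E.Hom Q (wholeGroup S) := by
      refine E.comp_mem ?_ hα.1
      have h := E.conj_mem 1 (one_mem T) Q (wholeGroup S) fun _ _ => trivial
      convert h using 1
      ext x
      simp [inclHom, conjHom]
    have hmod := E.trivial_mod Q _ hin ⟨t, htQ⟩
    have hT : ((α ⟨t, htQ⟩ : Q) : S) ∈ T := by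
      have h2 := mul_mem hmod htT
      simpa [inclHom] using h2
    have hQ : ((α ⟨t, htQ⟩ : Q) : S) ∈ Q := (α ⟨t, htQ⟩).2
    refine ⟨(α ⟨t, htQ⟩ : Q), ⟨⟨hT, hQ⟩, Subgroup.le_normalizer (H := Q.toSubgroup) hQ⟩,
      fun x => ?_⟩
    change ((α (γ (α⁻¹ x)) : Q) : S) = _
    have e : γ (α⁻¹ x) = ⟨t, htQ⟩ * α⁻¹ x * ⟨t, htQ⟩⁻¹ := Subtype.ext (ht (α⁻¹ x))
    rw [e, map_mul, map_mul, map_inv, MulAut.apply_inv_self]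
    rfl

/-- `N^T_φ`, the group of all `x ∈ N_T(R) R` for which there is `y ∈ N_T(Q) Q` such that
`φ(x u x⁻¹) = y φ(u) y⁻¹` for all `u ∈ R`. -/
def extDomain {R Q : ClosedSubgroup S} (φ : R ≃* Q) (hφ : HomFamily.IsIso E.Hom φ) :
    ClosedSubgroup S where
  carrier := {x | ∃ hx : x ∈ normMul T R, ∃ y ∈ normMul T Q, ∀ u : R,
    (φ ⟨x * u * x⁻¹, normMul_conj_mem hx u.2⟩ : S) = y * φ u * y⁻¹}
  one_mem' := ⟨one_mem _, 1, one_mem _, fun u => by simp⟩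
  mul_mem' := by
    rintro a b ⟨ha, y, hy, h⟩ ⟨hb, z, hz, h'⟩
    refine ⟨mul_mem ha hb, y * z, mul_mem hy hz, fun u => ?_⟩
    have h1 := h ⟨b * u * b⁻¹, normMul_conj_mem hb u.2⟩
    rw [h' u] at h1
    have e : (⟨a * b * u * (a * b)⁻¹, normMul_conj_mem (mul_mem ha hb) u.2⟩ : R) =
        ⟨a * (b * u * b⁻¹) * a⁻¹, normMul_conj_mem ha (normMul_conj_mem hb u.2)⟩ :=
      Subtype.ext (by simp only [mul_assoc, mul_inv_rev])
    rw [e]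
    refine h1.trans ?_
    simp only [mul_assoc, mul_inv_rev]
  inv_mem' := by
    rintro a ⟨ha, y, hy, h⟩
    refine ⟨inv_mem ha, y⁻¹, inv_mem hy, fun u => ?_⟩
    have h1 := h ⟨a⁻¹ * u * a⁻¹⁻¹, normMul_conj_mem (inv_mem ha) u.2⟩
    have e : (⟨a * (a⁻¹ * u * a⁻¹⁻¹) * a⁻¹,
        normMul_conj_mem ha (normMul_conj_mem (inv_mem ha) u.2)⟩ : R) = u :=
      Subtype.ext (by simp only [inv_inv]; group)
    rw [e] at h1
    rw [h1]
    group
  isClosed' := by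
    have hc : Continuous φ := F.continuous_of_mem (E.subset _ _ hφ.1)
    let K : Set (normMul T R × normMul T Q) := {z | ∀ u : R,
      (φ ⟨z.1 * u * (z.1 : S)⁻¹, normMul_conj_mem z.1.2 u.2⟩ : S) = z.2 * φ u * (z.2 : S)⁻¹}
    have hK : IsClosed K := by
      have : K = ⋂ u : R, {z : normMul T R × normMul T Q |
        (φ ⟨z.1 * u * (z.1 : S)⁻¹, normMul_conj_mem z.1.2 u.2⟩ : S) =
          z.2 * φ u * (z.2 : S)⁻¹} := by
        ext z
        simp [K]
      rw [this]
      refine isClosed_iInter fun u => isClosed_eq ?_ (by fun_prop)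
      exact continuous_subtype_val.comp
        (hc.comp (Continuous.subtype_mk (by fun_prop) _))
    have hI : IsClosed ((fun z : normMul T R × normMul T Q => (z.1 : S)) '' K) :=
      (hK.isCompact.image (by fun_prop)).isClosed
    convert hI using 1
    ext x
    constructor
    · rintro ⟨hx, y, hy, h⟩
      exact ⟨(⟨x, hx⟩, ⟨y, hy⟩), h, rfl⟩
    · rintro ⟨⟨⟨x, hx⟩, ⟨y, hy⟩⟩, h, rfl⟩
      exact ⟨hx, y, hy, h⟩

end

end TSubsystem

/-! ### Pro-`p` groups, Sylow pro-`p` subgroups, posets of `p`-subgroups -/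

/-- The profinite group `G` is a pro-`p` group. -/
def IsProP (p : ℕ) (G : Type*) [Group G] [TopologicalSpace G] : Prop :=
  ∀ N : Subgroup G, N.Normal → IsOpen (N : Set G) → ∃ k : ℕ, N.index = p ^ k

/-- `H` is a Sylow pro-`p` subgroup of the profinite group `G`: a closed pro-`p` subgroup whose
(supernatural) index is prime to `p`. -/
def IsSylowProP (p : ℕ) {G : Type*} [Group G] [TopologicalSpace G] (H : Subgroup G) : Prop :=
  IsClosed (H : Set G) ∧ IsProP p H ∧
    ∀ U : Subgroup G, IsOpen (U : Set G) → H ≤ U → ¬ p ∣ U.index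

/-- The set `S_p(G)` of non-trivial (closed, pro-)`p`-subgroups of the profinite group `G`, ordered
by inclusion. -/
def SpPoset (p : ℕ) (G : Type*) [Group G] [TopologicalSpace G] : Type _ :=
  {H : Subgroup G // IsClosed (H : Set G) ∧ IsProP p H ∧ H ≠ ⊥}

instance (p : ℕ) (G : Type*) [Group G] [TopologicalSpace G] : PartialOrder (SpPoset p G) :=
  inferInstanceAs (PartialOrder {H : Subgroup G // IsClosed (H : Set G) ∧ IsProP p H ∧ H ≠ ⊥})

/-- The poset `X` is connected: it is non-empty, and any two elements are joined by a finite
sequence of elements in which neighbours are comparable. -/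
def PosetConnected (X : Type*) [PartialOrder X] : Prop :=
  Nonempty X ∧ ∀ a b : X, Relation.EqvGen (· ≤ ·) a b

/-! ### Saturation and essential subgroups -/

namespace TSubsystem

section

variable {p : ℕ} {S : Type u} [Group S] [TopologicalSpace S] [IsTopologicalGroup S]
  [CompactSpace S] [T2Space S] {F : ProFusionSystem.{u, v, w} p S} {T : ClosedSubgroup S}
  (E : TSubsystem F T)

/-- `Q` is receptive in `E`: every `φ ∈ Iso_E(R, Q)` extends to a morphism `N^T_φ → N_T(Q) Q`. -/
def Receptive (Q : ClosedSubgroup S) : Prop :=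
  ∀ (R : ClosedSubgroup S) (φ : R ≃* Q) (hφ : HomFamily.IsIso E.Hom φ),
    ∃ ψ ∈ E.Hom (E.extDomain φ hφ) (normMul T Q),
      ∀ (x : E.extDomain φ hφ) (hx : (x : S) ∈ R), (ψ x : S) = φ ⟨x, hx⟩

/-- `Q` is fully normalized in `E`. -/
def FullyNormalized (Q : ClosedSubgroup S) : Prop :=
  E.Receptive Q ∧ IsSylowProP p (E.innerAut T.toSubgroup Q)

/-- `Q` and `Q'` lie in the same `E`-isomorphism class. -/
def Isomorphic (Q Q' : ClosedSubgroup S) : Prop :=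
  ∃ θ : Q ≃* Q', HomFamily.IsIso E.Hom θ

/-- `E` is saturated. -/
def Saturated : Prop :=
  ∀ Q : ClosedSubgroup S, ∃ Q' : ClosedSubgroup S, E.Isomorphic Q Q' ∧ E.FullyNormalized Q'

/-- `Q` is `E`-centric: `C_T(Q') ≤ Z(Q')` for all `Q'` in the `E`-isomorphism class of `Q`. -/
def Centric (Q : ClosedSubgroup S) : Prop :=
  ∀ Q' : ClosedSubgroup S, E.Isomorphic Q Q' →
    T.toSubgroup ⊓ Subgroup.centralizer (Q' : Set S) ≤
      (Subgroup.center Q'.toSubgroup).map Q'.toSubgroup.subtype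

/-- `Q` is `E`-essential. -/
def Essential (Q : ClosedSubgroup S) : Prop :=
  T ≤ Q ∨ (E.Centric Q ∧
    ¬ PosetConnected
      (SpPoset p (E.aut Q ⧸ E.innerAut (T.toSubgroup ⊓ Q.toSubgroup) Q)))

end

end TSubsystem

/-! The proof is Alperin's argument, by strong induction on the index of `P`. The finite projections
of isomorphic closed subgroups have equal orders, so isomorphisms of `E` preserve openness and index
(`isOpen_and_index_eq`). An isomorphism that extends to a strictly larger subgroup therefore
decomposes by induction, since restrictions of decomposable isomorphisms decompose
(`decomposes_of_mem_extDomain`).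

By saturation `P` and `P'` are isomorphic to one fully normalized `Q`, and it suffices to decompose
an isomorphism `χ : R → Q` (`decomposes_to_fullyNormalized`). If `T ≤ R`, then `R = Q`, because `E`
moves elements only modulo `T`. Otherwise `N_T(R)` is not contained in `R`, and Sylow's theorem
gives `g` in `Aut_E(Q)` such that `g⁻¹χ` carries `Aut_T(R)` into `Aut_T(Q)`. Receptivity then
extends `g⁻¹χ` to a larger subgroup, so only the automorphism `g` of `Q` is left.

Automorphisms of `Q` are treated in `decomposes_aut`. If `Q` is essential there is nothing to do. If
`Q` is not centric, some element of `C_T(Q)` lies outside `Q`, and every automorphism extends to it.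
In the remaining case the poset of `p`-subgroups of `Aut_E(Q)/Aut_{T∩Q}(Q)` is connected. A path in
it from the image of `Aut_T(Q)` to its conjugate by `γ` writes `γ` as a product of automorphisms
each of which extends, up to inversion (`decomposes_of_posetConnected`).

Sylow's theorem is applied in the compact group `Aut_E(Q)`, whose topology is controlled by the
kernels `autKer` of its actions on the finite groups `f_i(Q)`. -/

open Topology

set_option linter.unusedSectionVars false

/-! ### Finite projections, open subgroups and the topology of `Hom_F(P, Q)`. -/

namespace ProFusionSystem

section

variable {p : ℕ} {S : Type u} [Group S] [TopologicalSpace S] (F : ProFusionSystem.{u, v, w} p S)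

theorem map_proj {i j : F.sys.I} (hij : i ≤ j) (x : S) :
    F.sys.map hij (F.proj j x) = F.proj i x :=
  (F.iso x).2 i j hij

theorem proj_eq_of_le {i j : F.sys.I} (hij : i ≤ j) {x y : S} (h : F.proj j x = F.proj j y) :
    F.proj i x = F.proj i y := by
  rw [← F.map_proj hij, h, F.map_proj hij]

theorem exists_proj_fiber_subset {U : Set S} (hU : IsOpen U) {x : S} (hx : x ∈ U) :
    ∃ i, ∀ y, F.proj i y = F.proj i x → y ∈ U := by
  have hind : IsInducing fun y : S => ((F.iso y : F.sys.limit) : ∀ i, F.sys.S i) :=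
    IsInducing.subtypeVal.comp F.iso.toHomeomorph.isInducing
  obtain ⟨V, hV, rfl⟩ := hind.isOpen_iff.1 hU
  obtain ⟨I₀, u, hu, hsub⟩ := isOpen_pi_iff.1 hV _ hx
  obtain ⟨i, hi⟩ := I₀.exists_le
  refine ⟨i, fun y hy => hsub fun j hj => ?_⟩
  have h : F.proj j y = F.proj j x := F.proj_eq_of_le (hi j hj) hy
  change F.proj j y ∈ u j
  rw [h]
  exact (hu j hj).2

theorem isOpen_proj_fiber (i : F.sys.I) (x : S) : IsOpen {y | F.proj i y = F.proj i x} :=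
  (isOpen_discrete {F.proj i x}).preimage (F.continuous_proj i)

theorem isOpen_ker_proj (i : F.sys.I) : IsOpen ((F.proj i).ker : Set S) := by
  have h := F.isOpen_proj_fiber i 1
  rw [map_one] at h
  exact h

theorem exists_ker_proj_le {P : Subgroup S} (hP : IsOpen (P : Set S)) :
    ∃ i, (F.proj i).ker ≤ P := by
  obtain ⟨i, hi⟩ := F.exists_proj_fiber_subset hP (one_mem P)
  exact ⟨i, fun y hy => hi y (by rw [map_one]; exact hy)⟩

theorem mem_of_forall_proj {Q : Set S} (hQ : IsClosed Q) {x : S}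
    (h : ∀ i, ∃ q ∈ Q, F.proj i q = F.proj i x) : x ∈ Q := by
  by_contra hx
  obtain ⟨i, hi⟩ := F.exists_proj_fiber_subset hQ.isOpen_compl hx
  obtain ⟨q, hq, hqx⟩ := h i
  exact hi q hqx hq

theorem eq_of_forall_proj {x y : S} (h : ∀ i, F.proj i x = F.proj i y) : x = y :=
  F.iso.injective (Subtype.ext (funext h))

theorem exists_pow_proj_eq_one (i : F.sys.I) (x : S) : ∃ k : ℕ, F.proj i (x ^ p ^ k) = 1 := by
  obtain ⟨k, hk⟩ := F.sys.isPGroup i (F.proj i x)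
  exact ⟨k, by rw [map_pow, hk]⟩

variable {F}

theorem proj_congr {P Q : ClosedSubgroup S} {φ : P →* Q} (hφ : φ ∈ F.Hom P Q) {i : F.sys.I}
    {x y : P} (h : F.proj i x = F.proj i y) : F.proj i (φ x : Q) = F.proj i (φ y : Q) := by
  obtain ⟨ψ, -, hψ⟩ := hφ i
  rw [← hψ, ← hψ]
  congr 2
  exact Subtype.ext h

theorem proj_eq_of_proj_map_eq {P Q : ClosedSubgroup S} {φ : P →* Q} (hφ : φ ∈ F.Hom P Q)
    {i : F.sys.I} {x y : P} (h : F.proj i (φ x : Q) = F.proj i (φ y : Q)) :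
    F.proj i x = F.proj i y := by
  obtain ⟨ψ, hm, hψ⟩ := hφ i
  rw [← hψ, ← hψ] at h
  exact congrArg Subtype.val ((F.sys.fusion i).injective hm (Subtype.ext h))

theorem injective_of_mem {P Q : ClosedSubgroup S} {φ : P →* Q} (hφ : φ ∈ F.Hom P Q) :
    Function.Injective φ := fun x y h =>
  Subtype.ext (F.eq_of_forall_proj fun i => proj_eq_of_proj_map_eq hφ (by rw [h]))

theorem card_map_proj_eq {P Q : ClosedSubgroup S} {φ : P →* Q} (hφ : φ ∈ F.Hom P Q)
    (hs : Function.Surjective φ) (i : F.sys.I) :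
    Nat.card (P.toSubgroup.map (F.proj i)) = Nat.card (Q.toSubgroup.map (F.proj i)) := by
  obtain ⟨ψ, hm, hψ⟩ := hφ i
  refine Nat.card_eq_of_bijective ψ ⟨(F.sys.fusion i).injective hm, ?_⟩
  rintro ⟨_, y, hy, rfl⟩
  obtain ⟨x, hx⟩ := hs ⟨y, hy⟩
  refine ⟨⟨F.proj i x, Subgroup.mem_map_of_mem _ x.2⟩, Subtype.ext ?_⟩
  rw [hψ, hx]

/-- At each finite level an injective endomorphism of `f_i(Q)` is onto, so the image of `φ` is dense
in `Q`; by compactness it is closed. -/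
theorem surjective_of_mem [CompactSpace S] [T2Space S] {Q : ClosedSubgroup S} {φ : Q →* Q}
    (hφ : φ ∈ F.Hom Q Q) : Function.Surjective φ := by
  intro y
  have hy : (y : S) ∈ F.image φ hφ Q le_rfl := by
    refine F.mem_of_forall_proj (F.image φ hφ Q le_rfl).isClosed' fun i => ?_
    obtain ⟨ψ, hm, hψ⟩ := hφ i
    obtain ⟨⟨_, x, hx, rfl⟩, h⟩ := Finite.injective_iff_surjective.1
      ((F.sys.fusion i).injective hm) ⟨F.proj i y, Subgroup.mem_map_of_mem _ y.2⟩
    refine ⟨φ ⟨x, hx⟩, ⟨⟨x, hx⟩, rfl⟩, ?_⟩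
    rw [← hψ]
    exact congrArg Subtype.val h
  obtain ⟨x, hx⟩ := hy
  exact ⟨x, Subtype.ext hx⟩

theorem conjHom_mem (s : S) (P Q : ClosedSubgroup S) (h : ∀ x ∈ P, s * x * s⁻¹ ∈ Q) :
    conjHom s P Q h ∈ F.Hom P Q := by
  intro i
  refine ⟨_, (F.sys.fusion i).conj_mem (F.proj i s) _ _ ?_, ?_⟩
  · rintro _ ⟨x, hx, rfl⟩
    exact ⟨s * x * s⁻¹, h x hx, by simp⟩
  · intro x
    simp [conjHom]

theorem StronglyClosed.normal {T : ClosedSubgroup S} (hT : F.StronglyClosed T) :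
    T.toSubgroup.Normal :=
  ⟨fun t ht s => hT T _ (conjHom_mem s T (wholeGroup S) fun _ _ => trivial) le_rfl ⟨t, ht⟩⟩

theorem index_sup_ker_eq {P Q : Subgroup S} {i : F.sys.I}
    (h : Nat.card (P.map (F.proj i)) = Nat.card (Q.map (F.proj i))) :
    (P ⊔ (F.proj i).ker).index = (Q ⊔ (F.proj i).ker).index := by
  have h1 := (P.map (F.proj i)).card_mul_index
  have h2 := (Q.map (F.proj i)).card_mul_index
  -- The projection to `S_i` need not be onto; the index of its range is a common factor of both
  -- sides and cancels.
  rw [Subgroup.index_map] at h1 h2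
  rw [← h2, h] at h1
  exact Nat.eq_of_mul_eq_mul_right (Nat.pos_of_ne_zero Subgroup.index_ne_zero_of_finite)
    (Nat.eq_of_mul_eq_mul_left Nat.card_pos h1)

/-- Once `ker f_i ≤ P`, the subgroups `Q ker f_j` with `j ≥ i` all have the index of `P`. They form
a decreasing family, hence coincide, and their intersection is `Q` because `Q` is closed. -/
theorem isOpen_and_index_eq [IsTopologicalGroup S] [CompactSpace S] {P Q : ClosedSubgroup S}
    (hP : IsOpen (P : Set S)) {φ : P →* Q} (hφ : φ ∈ F.Hom P Q) (hs : Function.Surjective φ) :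
    IsOpen (Q : Set S) ∧ Q.toSubgroup.index = P.toSubgroup.index := by
  obtain ⟨i, hi⟩ := F.exists_ker_proj_le (P := P.toSubgroup) hP
  have hker : ∀ j, i ≤ j → (F.proj j).ker ≤ (F.proj i).ker := fun j hij x hx => by
    have := F.proj_eq_of_le hij (x := x) (y := 1) (by rw [map_one]; exact hx)
    rwa [map_one] at this
  have hidx : ∀ j, i ≤ j → (Q.toSubgroup ⊔ (F.proj j).ker).index = P.toSubgroup.index := by
    intro j hij
    rw [← index_sup_ker_eq (card_map_proj_eq hφ hs j), sup_eq_left.2 ((hker j hij).trans hi)]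
  have hQ : Q.toSubgroup ⊔ (F.proj i).ker = Q.toSubgroup := by
    refine le_antisymm (fun x hx => ?_) le_sup_left
    refine F.mem_of_forall_proj Q.isClosed' fun j => ?_
    obtain ⟨k, hik, hjk⟩ := exists_ge_ge i j
    have hle : Q.toSubgroup ⊔ (F.proj k).ker ≤ Q.toSubgroup ⊔ (F.proj i).ker :=
      sup_le_sup_left (hker k hik) _
    have hfin : (Q.toSubgroup ⊔ (F.proj i).ker).FiniteIndex := by
      refine ⟨?_⟩
      rw [hidx i le_rfl]
      have := P.toSubgroup.quotient_finite_of_isOpen hP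
      exact Subgroup.index_ne_zero_of_finite
    have heq : Q.toSubgroup ⊔ (F.proj k).ker = Q.toSubgroup ⊔ (F.proj i).ker := by
      refine le_antisymm hle (Subgroup.relIndex_eq_one.1 ?_)
      have h := Subgroup.relIndex_mul_index hle
      rw [hidx k hik, hidx i le_rfl] at h
      have h0 := hfin.index_ne_zero
      rw [hidx i le_rfl] at h0
      exact Nat.eq_of_mul_eq_mul_right (Nat.pos_of_ne_zero h0) (by rw [h, one_mul])
    rw [← heq] at hx
    rw [← SetLike.mem_coe, Subgroup.mul_normal] at hx
    obtain ⟨q, hq, n, hn, rfl⟩ := hx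
    refine ⟨q, hq, F.proj_eq_of_le hjk ?_⟩
    change _ = F.proj k (q * n)
    rw [map_mul, (hn : F.proj k n = 1), mul_one]
  refine ⟨?_, by rw [← hidx i le_rfl, hQ]⟩
  have := Subgroup.isOpen_mono (H₁ := (F.proj i).ker) (H₂ := Q.toSubgroup)
    (hQ ▸ le_sup_right) (F.isOpen_ker_proj i)
  exact this

variable (F) in
theorem nhds_hom {P Q : ClosedSubgroup S} (φ : F.Hom P Q) :
    𝓝 φ = ⨅ i, Filter.principal {φ' : F.Hom P Q |
      ∀ x : P, F.proj i (φ'.1 x : Q) = F.proj i (φ.1 x : Q)} := by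
  rw [nhds_iInf]
  refine iInf_congr fun i => ?_
  let _ : TopologicalSpace (P → F.sys.S i) := ⊥
  have : DiscreteTopology (P → F.sys.S i) := ⟨rfl⟩
  rw [nhds_induced, nhds_discrete, ← Filter.principal_singleton, Filter.comap_principal]
  congr 1
  ext φ'
  simp [funext_iff]

theorem directed_hom_fibers {P Q : ClosedSubgroup S} (φ : F.Hom P Q) :
    Directed (· ≥ ·) fun i => {φ' : F.Hom P Q |
      ∀ x : P, F.proj i (φ'.1 x : Q) = F.proj i (φ.1 x : Q)} := by
  intro i j
  obtain ⟨k, hik, hjk⟩ := exists_ge_ge i j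
  exact ⟨k, fun φ' h x => F.proj_eq_of_le hik (h x), fun φ' h x => F.proj_eq_of_le hjk (h x)⟩

theorem hasBasis_nhds_hom {P Q : ClosedSubgroup S} (φ : F.Hom P Q) :
    (𝓝 φ).HasBasis (fun _ : F.sys.I => True) fun i => {φ' : F.Hom P Q |
      ∀ x : P, F.proj i (φ'.1 x : Q) = F.proj i (φ.1 x : Q)} := by
  rw [nhds_hom]
  exact Filter.hasBasis_iInf_principal (directed_hom_fibers φ)

/-- Each level has only finitely many homomorphisms, so along an ultrafilter every component is
eventually constant. These constants are compatible and define the limit. -/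
instance compactSpace_hom (P Q : ClosedSubgroup S) : CompactSpace (F.Hom P Q) := by
  refine ⟨isCompact_iff_ultrafilter_le_nhds.2 fun 𝒰 _ => ?_⟩
  choose r hrmem hr using fun (φ : F.Hom P Q) (i : F.sys.I) => φ.2 i
  have hfin : ∀ i, Finite (P.toSubgroup.map (F.proj i) →* Q.toSubgroup.map (F.proj i)) :=
    fun i => Finite.of_injective _ (DFunLike.coe_injective)
  have hev : ∀ i, ∃ ψ, ∀ᶠ φ in (𝒰 : Filter (F.Hom P Q)), r φ i = ψ := by
    intro i
    obtain ⟨ψ, hψ⟩ := (𝒰.map fun φ => r φ i).eq_pure_of_finite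
    refine ⟨ψ, ?_⟩
    have : ({ψ} : Set _) ∈ 𝒰.map fun φ => r φ i := by rw [hψ]; exact rfl
    exact this
  choose ψ hψ using hev
  have hlim : ∀ x : P, (fun i => ((ψ i ⟨F.proj i x, Subgroup.mem_map_of_mem _ x.2⟩ :
      Q.toSubgroup.map (F.proj i)) : F.sys.S i)) ∈ F.sys.limit := by
    intro x i j hij
    obtain ⟨φ, hi, hj⟩ := ((hψ i).and (hψ j)).exists
    beta_reduce
    rw [← hi, ← hj, hr, hr]
    exact F.map_proj hij _
  let g : P → S := fun x => F.iso.symm ⟨_, hlim x⟩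
  have hg : ∀ (i) (x : P), F.proj i (g x) =
      (ψ i ⟨F.proj i x, Subgroup.mem_map_of_mem _ x.2⟩ : Q.toSubgroup.map (F.proj i)) := by
    intro i x
    change (F.iso (F.iso.symm ⟨_, hlim x⟩)).1 i = _
    rw [F.iso.apply_symm_apply]
  have hgQ : ∀ x, g x ∈ Q := fun x => F.mem_of_forall_proj Q.isClosed' fun i => by
    rw [hg]
    exact (ψ i ⟨F.proj i x, _⟩).2
  let φ : P →* Q :=
    { toFun := fun x => ⟨g x, hgQ x⟩
      map_one' := Subtype.ext (F.eq_of_forall_proj fun i => by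
        have e : (⟨F.proj i (1 : P), Subgroup.mem_map_of_mem _ (1 : P).2⟩ :
          P.toSubgroup.map (F.proj i)) = 1 := Subtype.ext (map_one (F.proj i))
        change F.proj i (g 1) = F.proj i 1
        rw [hg, e, map_one, map_one]
        rfl)
      map_mul' := fun x y => Subtype.ext (F.eq_of_forall_proj fun i => by
        have e : (⟨F.proj i (x * y : P), Subgroup.mem_map_of_mem _ (x * y : P).2⟩ :
          P.toSubgroup.map (F.proj i)) = ⟨F.proj i x, Subgroup.mem_map_of_mem _ x.2⟩ *
            ⟨F.proj i y, Subgroup.mem_map_of_mem _ y.2⟩ := Subtype.ext (map_mul (F.proj i) _ _)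
        change F.proj i (g (x * y)) = F.proj i (g x * g y)
        rw [hg, e, map_mul, map_mul, hg, hg]
        rfl) }
  have hφ : φ ∈ F.Hom P Q := fun i => by
    obtain ⟨φ', h⟩ := (hψ i).exists
    exact ⟨ψ i, h ▸ hrmem φ' i, fun x => (hg i x).symm⟩
  refine ⟨⟨φ, hφ⟩, trivial, (hasBasis_nhds_hom _).ge_iff.2 fun i _ => ?_⟩
  filter_upwards [hψ i] with φ' h x
  rw [← hr φ' i, h]
  exact (hg i x).symm

end

end ProFusionSystem

/-! ### Sylow's theorem in compact groups and the normalizer condition. -/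

/-- Sylow's theorem for a compact group `G` in which the open normal subgroups `K i` form a
neighbourhood basis of `1`: a subgroup all of whose elements have `p`-power order modulo each `K i`
is conjugate to a subgroup of any closed subgroup whose index is prime to `p`. -/
theorem exists_conj_mem_of_not_dvd_index {G ι : Type*} [Group G] [TopologicalSpace G]
    [IsTopologicalGroup G] [CompactSpace G] [Preorder ι] [IsDirectedOrder ι] [Nonempty ι] {p : ℕ}
    [Fact p.Prime] (K : ι → Subgroup G) [∀ i, (K i).Normal] (hopen : ∀ i, IsOpen (K i : Set G))
    (hanti : Antitone K) (hbasis : ∀ U ∈ 𝓝 (1 : G), ∃ i, (K i : Set G) ⊆ U) {X Y : Subgroup G}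
    (hX : IsClosed (X : Set G))
    (hindex : ∀ U : Subgroup G, IsOpen (U : Set G) → X ≤ U → ¬ p ∣ U.index)
    (hY : ∀ y ∈ Y, ∀ i, ∃ k : ℕ, y ^ p ^ k ∈ K i) :
    ∃ g : G, ∀ y ∈ Y, g⁻¹ * y * g ∈ X := by
  have hUopen : ∀ i, IsOpen ((X ⊔ K i : Subgroup G) : Set G) := fun i =>
    Subgroup.isOpen_mono le_sup_right (hopen i)
  let C : ι → Set G := fun i => {g | ∀ y ∈ Y, g⁻¹ * y * g ∈ X ⊔ K i}
  have hCclosed : ∀ i, IsClosed (C i) := by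
    intro i
    have : C i = ⋂ y ∈ Y, {g | g⁻¹ * y * g ∈ X ⊔ K i} := by
      ext g
      simp [C]
    rw [this]
    exact isClosed_biInter fun y _ =>
      (Subgroup.isClosed_of_isOpen _ (hUopen i)).preimage (by fun_prop)
  have hCdir : Directed (· ⊇ ·) C := by
    intro i j
    obtain ⟨k, hik, hjk⟩ := exists_ge_ge i j
    exact ⟨k, fun g hg y hy => sup_le_sup_left (hanti hik) X (hg y hy),
      fun g hg y hy => sup_le_sup_left (hanti hjk) X (hg y hy)⟩
  -- Since `K i` acts trivially on `G ⧸ X K_i`, the group `Y` acts as a finite `p`-group on a set of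
  -- size prime to `p`. A fixed coset `g X K_i` gives the required `g`.
  have hCne : ∀ i, (C i).Nonempty := by
    intro i
    let U : Subgroup G := X ⊔ K i
    have : Finite (G ⧸ U) := U.quotient_finite_of_isOpen (hUopen i)
    let f : Y →* Equiv.Perm (G ⧸ U) := (MulAction.toPermHom G (G ⧸ U)).comp Y.subtype
    have hker : ∀ n ∈ K i, MulAction.toPermHom G (G ⧸ U) n = 1 := by
      intro n hn
      ext z
      obtain ⟨g, rfl⟩ := QuotientGroup.mk_surjective z
      change ((n * g : G) : G ⧸ U) = (g : G ⧸ U)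
      rw [eq_comm, QuotientGroup.eq]
      refine (le_sup_right : K i ≤ U) ?_
      rw [← mul_assoc]
      simpa using Subgroup.Normal.conj_mem inferInstance n hn g⁻¹
    have hpg : IsPGroup p f.range := by
      rintro ⟨_, y, rfl⟩
      obtain ⟨k, hk⟩ := hY y y.2 i
      refine ⟨k, Subtype.ext ?_⟩
      change (f y) ^ p ^ k = 1
      rw [← map_pow]
      exact hker _ hk
    obtain ⟨z, hz⟩ := hpg.nonempty_fixed_point_of_prime_not_dvd_card (G ⧸ U)
      (hindex U (hUopen i) le_sup_left)
    obtain ⟨g, rfl⟩ := QuotientGroup.mk_surjective z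
    refine ⟨g, fun y hy => ?_⟩
    have h : ((y * g : G) : G ⧸ U) = (g : G ⧸ U) := hz ⟨f ⟨y, hy⟩, ⟨_, rfl⟩⟩
    rw [eq_comm, QuotientGroup.eq] at h
    rwa [mul_assoc]
  obtain ⟨g, hg⟩ := IsCompact.nonempty_iInter_of_directed_nonempty_isCompact_isClosed C hCdir hCne
    (fun i => (hCclosed i).isCompact) hCclosed
  rw [Set.mem_iInter] at hg
  refine ⟨g, fun y hy => ?_⟩
  by_contra hx
  -- As `X` is closed, an element outside `X` lies outside `X K_i` for some `i`.
  have hU : {z : G | g⁻¹ * y * g * z⁻¹ ∉ X} ∈ 𝓝 (1 : G) :=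
    (hX.isOpen_compl.preimage (f := fun z : G => g⁻¹ * y * g * z⁻¹) (by fun_prop)).mem_nhds
      (by simpa using hx)
  obtain ⟨i, hi⟩ := hbasis _ hU
  have h := hg i y hy
  rw [← SetLike.mem_coe, Subgroup.mul_normal] at h
  obtain ⟨x, hxX, n, hn, hxn⟩ := h
  refine hi hn ?_
  simp only [← hxn, mul_inv_cancel_right]
  exact hxX

theorem Subgroup.exists_mem_normalizer_notMem {G : Type*} [Group G] [Finite G] {p : ℕ}
    [Fact p.Prime] (hG : IsPGroup p G) {H K : Subgroup G} (hHK : H < K) :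
    ∃ g ∈ K, g ∉ H ∧ g ∈ normalizer (H : Set G) := by
  have := (hG.to_subgroup K).isNilpotent
  have hlt : H.subgroupOf K < ⊤ := by
    rw [lt_top_iff_ne_top, Ne, Subgroup.subgroupOf_eq_top]
    exact hHK.not_ge
  obtain ⟨g, hg, hgH⟩ := SetLike.exists_of_lt (Group.normalizerCondition_of_isNilpotent _ hlt)
  refine ⟨g, g.2, hgH, Subgroup.mem_normalizer_iff.2 fun h => ⟨fun hh => ?_, fun hh => ?_⟩⟩
  · exact (Subgroup.mem_normalizer_iff.1 hg ⟨h, hHK.le hh⟩).1 hh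
  · have hK : h ∈ K := by
      have := K.mul_mem (K.mul_mem (K.inv_mem g.2) (hHK.le hh)) g.2
      simpa [mul_assoc] using this
    exact (Subgroup.mem_normalizer_iff.1 hg ⟨h, hK⟩).2 hh

/-! ### Normalizers in `T`, and `Aut_E(Q)` as a compact topological group. -/

namespace TSubsystem

section

variable {p : ℕ} {S : Type u} [Group S] [TopologicalSpace S] [IsTopologicalGroup S]
  [CompactSpace S] [T2Space S] {F : ProFusionSystem.{u, v, w} p S} {T : ClosedSubgroup S}

/-- If `P` is open and does not contain `T`, then neither does it contain `N_T(P)`. -/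
theorem exists_mem_normalizer_notMem [Fact p.Prime] (hT : F.StronglyClosed T)
    {P : ClosedSubgroup S} (hP : IsOpen (P : Set S)) (hTP : ¬ T ≤ P) :
    ∃ t ∈ T, t ∈ Subgroup.normalizer (P : Set S) ∧ t ∉ P := by
  have := hT.normal
  obtain ⟨i, hi⟩ := F.exists_ker_proj_le (P := P.toSubgroup) hP
  have hmem : ∀ x, F.proj i x ∈ P.toSubgroup.map (F.proj i) → x ∈ P := by
    rintro x ⟨y, hy, hyx⟩
    have h : y⁻¹ * x ∈ P.toSubgroup :=
      hi (by rw [MonoidHom.mem_ker, map_mul, map_inv, hyx, inv_mul_cancel])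
    have hx : x ∈ P.toSubgroup := by simpa using mul_mem hy h
    exact hx
  -- `P` is the full preimage of `f_i(P)`, so the normalizer condition can be applied to `f_i(P) <
  -- f_i(PT)` in the finite `p`-group `S_i`.
  have hlt : P.toSubgroup.map (F.proj i) < (P.toSubgroup ⊔ T.toSubgroup).map (F.proj i) := by
    refine lt_of_le_not_ge (Subgroup.map_mono le_sup_left) fun h => hTP fun t ht => ?_
    exact hmem t (h (Subgroup.mem_map_of_mem _ ((le_sup_right : T.toSubgroup ≤ _) ht)))
  obtain ⟨_, ⟨x, hx, rfl⟩, hxP, hxn⟩ :=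
    Subgroup.exists_mem_normalizer_notMem (F.sys.isPGroup i) hlt
  rw [Subgroup.mul_normal] at hx
  obtain ⟨y, hy, t, ht, rfl⟩ := hx
  have hyn : F.proj i y ∈ Subgroup.normalizer (P.toSubgroup.map (F.proj i) : Set (F.sys.S i)) :=
    Subgroup.le_normalizer (Subgroup.mem_map_of_mem _ hy)
  -- The normalizing element is the image of `y t` with `y ∈ P`; the factor `y` normalizes and can
  -- be dropped.
  have htn : F.proj i t ∈ Subgroup.normalizer (P.toSubgroup.map (F.proj i) : Set (F.sys.S i)) := by
    have h := mul_mem (inv_mem hyn) hxn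
    simpa using h
  refine ⟨t, ht, Subgroup.mem_normalizer_iff.2 fun z => ?_, fun htP => hxP ?_⟩
  · have h := Subgroup.mem_normalizer_iff.1 htn (F.proj i z)
    rw [← map_mul, ← map_inv, ← map_mul] at h
    exact ⟨fun hz => hmem _ (h.1 (Subgroup.mem_map_of_mem _ hz)),
      fun hz => hmem _ (h.2 (Subgroup.mem_map_of_mem _ hz))⟩
  · exact Subgroup.mem_map_of_mem _ (mul_mem hy htP)

variable (E : TSubsystem F T)

theorem proj_aut_congr {Q : ClosedSubgroup S} (α : E.aut Q) {i : F.sys.I} {x y : Q}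
    (h : F.proj i x = F.proj i y) : F.proj i (α.1 x : Q) = F.proj i (α.1 y : Q) :=
  ProFusionSystem.proj_congr (E.autToHom Q α).2 h

/-- The automorphisms in `Aut_E(Q)` that induce the identity on `f_i(Q)`. -/
def autKer (Q : ClosedSubgroup S) (i : F.sys.I) : Subgroup (E.aut Q) where
  carrier := {α | ∀ x : Q, F.proj i (α.1 x : Q) = F.proj i x}
  one_mem' _ := rfl
  mul_mem' {α β} hα hβ x := (hα (β.1 x)).trans (hβ x)
  inv_mem' {α} hα x := by
    have h := hα ((α⁻¹).1 x)
    have e : α.1 ((α⁻¹).1 x) = x := MulAut.apply_inv_self _ _ _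
    rw [e] at h
    exact h.symm

instance autKer_normal (Q : ClosedSubgroup S) (i : F.sys.I) : (E.autKer Q i).Normal where
  conj_mem α hα γ x := by
    have h := E.proj_aut_congr γ (hα ((γ⁻¹).1 x))
    have e : γ.1 ((γ⁻¹).1 x) = x := MulAut.apply_inv_self _ _ _
    rw [e] at h
    exact h

theorem autKer_antitone (Q : ClosedSubgroup S) : Antitone (E.autKer Q) :=
  fun _ _ hij _ h x => F.proj_eq_of_le hij (h x)

theorem hasBasis_nhds_aut {Q : ClosedSubgroup S} (α : E.aut Q) :
    (𝓝 α).HasBasis (fun _ : F.sys.I => True)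
      fun i => {β : E.aut Q | ∀ x, F.proj i (β.1 x : Q) = F.proj i (α.1 x : Q)} := by
  rw [nhds_induced]
  exact (ProFusionSystem.hasBasis_nhds_hom (E.autToHom Q α)).comap _

theorem isOpen_autKer (Q : ClosedSubgroup S) (i : F.sys.I) :
    IsOpen (E.autKer Q i : Set (E.aut Q)) := by
  refine isOpen_iff_mem_nhds.2 fun α hα => ?_
  refine (E.hasBasis_nhds_aut α).mem_iff.2 ⟨i, trivial, fun β hβ x => (hβ x).trans (hα x)⟩

theorem exists_autKer_subset {Q : ClosedSubgroup S} {U : Set (E.aut Q)}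
    (hU : U ∈ 𝓝 (1 : E.aut Q)) : ∃ i, (E.autKer Q i : Set (E.aut Q)) ⊆ U := by
  obtain ⟨i, -, hi⟩ := (E.hasBasis_nhds_aut 1).mem_iff.1 hU
  exact ⟨i, hi⟩

instance isTopologicalGroup_aut (Q : ClosedSubgroup S) : IsTopologicalGroup (E.aut Q) where
  continuous_mul := by
    refine continuous_iff_continuousAt.2 fun ⟨α, β⟩ => ?_
    rw [ContinuousAt, nhds_prod_eq, ((E.hasBasis_nhds_aut α).prod
      (E.hasBasis_nhds_aut β)).tendsto_iff (E.hasBasis_nhds_aut _)]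
    refine fun i _ => ⟨(i, i), ⟨trivial, trivial⟩, fun ⟨α', β'⟩ ⟨hα, hβ⟩ x => ?_⟩
    exact (E.proj_aut_congr α' (hβ x)).trans (hα (β.1 x))
  continuous_inv := by
    refine continuous_iff_continuousAt.2 fun α => ?_
    rw [ContinuousAt, (E.hasBasis_nhds_aut α).tendsto_iff (E.hasBasis_nhds_aut _)]
    refine fun i _ => ⟨i, trivial, fun β hβ x => ?_⟩
    have h := E.proj_aut_congr β⁻¹ (hβ ((α⁻¹).1 x))
    have e : α.1 ((α⁻¹).1 x) = x := MulAut.apply_inv_self _ _ _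
    have e' : (β⁻¹).1 (β.1 ((α⁻¹).1 x)) = (α⁻¹).1 x := MulAut.inv_apply_self _ _ _
    rw [e, e'] at h
    exact h.symm

theorem isIso_of_mem {Q R : ClosedSubgroup S} {φ : Q →* R} (hφ : φ ∈ E.Hom Q R)
    (hs : Function.Surjective φ) :
    ∃ θ : Q ≃* R, HomFamily.IsIso E.Hom θ ∧ θ.toMonoidHom = φ := by
  obtain ⟨R', h, θ, hθ, rfl⟩ := E.factor hφ
  have hR : R' = R := by
    refine SetLike.ext fun x => ⟨h x, fun hx => ?_⟩
    obtain ⟨y, hy⟩ := hs ⟨x, hx⟩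
    have : ((θ y : R') : S) = x := congrArg Subtype.val hy
    rw [← this]
    exact (θ y).2
  subst hR
  exact ⟨θ, hθ, rfl⟩

/-- Endomorphisms of `Q` in `E` are automatically automorphisms, so `Aut_E(Q)` is identified with
the closed subset `Hom_E(Q, Q)` of the compact space `Hom_F(Q, Q)`. -/
instance compactSpace_aut (Q : ClosedSubgroup S) : CompactSpace (E.aut Q) := by
  have hinj : Function.Injective (E.autToHom Q) := by
    intro α β h
    refine Subtype.ext (MulEquiv.ext fun x => ?_)
    exact DFunLike.congr_fun (congrArg Subtype.val h) x
  have hrange : Set.range (E.autToHom Q) = {φ : F.Hom Q Q | φ.1 ∈ E.Hom Q Q} := by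
    ext φ
    constructor
    · rintro ⟨α, rfl⟩
      exact α.2.1
    · intro hφ
      obtain ⟨θ, hθ, h⟩ := E.isIso_of_mem hφ (ProFusionSystem.surjective_of_mem φ.2)
      exact ⟨⟨θ, hθ⟩, Subtype.ext h⟩
  have hemb : IsClosedEmbedding (E.autToHom Q) :=
    ⟨⟨⟨rfl⟩, hinj⟩, hrange ▸ E.isClosed Q Q⟩
  exact hemb.compactSpace

theorem exists_conj_mem_of_isSylowProP [Fact p.Prime] {Q : ClosedSubgroup S}
    {X Y : Subgroup (E.aut Q)} (hX : IsSylowProP p X)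
    (hY : ∀ y ∈ Y, ∀ i, ∃ k : ℕ, y ^ p ^ k ∈ E.autKer Q i) :
    ∃ g : E.aut Q, ∀ y ∈ Y, g⁻¹ * y * g ∈ X :=
  exists_conj_mem_of_not_dvd_index (E.autKer Q) (E.isOpen_autKer Q) (E.autKer_antitone Q)
    (fun _ => E.exists_autKer_subset) hX.1 hX.2.2 hY

end

end TSubsystem

/-! ### Composites of automorphisms of essential subgroups. -/

namespace TSubsystem

section

variable {p : ℕ} {S : Type u} [Group S] [TopologicalSpace S] [IsTopologicalGroup S]
  [CompactSpace S] [T2Space S] {F : ProFusionSystem.{u, v, w} p S} {T : ClosedSubgroup S}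
  (E : TSubsystem F T)

theorem inclHom_mem {P Q : ClosedSubgroup S} (h : ∀ x ∈ P, x ∈ Q) : inclHom P Q h ∈ E.Hom P Q := by
  convert E.conj_mem 1 (one_mem T) P Q (by simpa using h) using 1
  ext x
  simp [inclHom, conjHom]

variable {E} in
theorem isIso_trans {P Q R : ClosedSubgroup S} {φ : P ≃* Q} {ψ : Q ≃* R}
    (hφ : HomFamily.IsIso E.Hom φ) (hψ : HomFamily.IsIso E.Hom ψ) :
    HomFamily.IsIso E.Hom (φ.trans ψ) :=
  ⟨E.comp_mem hψ.1 hφ.1, E.comp_mem hφ.2 hψ.2⟩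

variable {E} in
theorem isIso_symm {P Q : ClosedSubgroup S} {φ : P ≃* Q} (hφ : HomFamily.IsIso E.Hom φ) :
    HomFamily.IsIso E.Hom φ.symm :=
  ⟨hφ.2, hφ.1⟩

theorem mul_inv_mem {P Q : ClosedSubgroup S} {φ : P →* Q} (hφ : φ ∈ E.Hom P Q) (x : P) :
    (φ x : S) * (x : S)⁻¹ ∈ T :=
  E.trivial_mod P _ (E.comp_mem (E.inclHom_mem (Q := wholeGroup S) fun _ _ => trivial) hφ) x

theorem isOpen_and_index_eq_of_isIso {P Q : ClosedSubgroup S} (hP : IsOpen (P : Set S))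
    {φ : P ≃* Q} (hφ : HomFamily.IsIso E.Hom φ) :
    IsOpen (Q : Set S) ∧ Q.toSubgroup.index = P.toSubgroup.index :=
  ProFusionSystem.isOpen_and_index_eq hP (E.subset _ _ hφ.1) φ.surjective

/-- An automorphism in `E` of an open, `E`-essential and fully normalized subgroup. -/
structure EssentialAut where
  domain : ClosedSubgroup S
  aut : E.aut domain
  isOpen : IsOpen (domain : Set S)
  essential : E.Essential domain
  fullyNormalized : E.FullyNormalized domain

namespace EssentialAut

variable {E}

/-- `s` maps `x` to `y`. -/
def Rel (s : E.EssentialAut) (x y : S) : Prop :=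
  ∃ hx : x ∈ s.domain, y = s.aut.1 ⟨x, hx⟩

/-- The inverse automorphism. -/
def inv (s : E.EssentialAut) : E.EssentialAut :=
  { s with aut := s.aut⁻¹ }

theorem Rel.inv {s : E.EssentialAut} {x y : S} (h : s.Rel x y) : s.inv.Rel y x := by
  obtain ⟨hx, rfl⟩ := h
  refine ⟨(s.aut.1 ⟨x, hx⟩).2, ?_⟩
  have e : (s.aut⁻¹).1 (s.aut.1 ⟨x, hx⟩) = ⟨x, hx⟩ := MulAut.inv_apply_self _ _ _
  exact (congrArg Subtype.val e).symm

/-- The composite of the automorphisms in the list `l`, the head of `l` applied first, maps `x`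
to `y`. -/
def Chain : List E.EssentialAut → S → S → Prop
  | [] => Eq
  | s :: l => Relation.Comp s.Rel (Chain l)

theorem Chain.append {l m : List E.EssentialAut} {x y z : S} (hl : Chain l x y)
    (hm : Chain m y z) : Chain (l ++ m) x z := by
  induction l generalizing x with
  | nil => exact (show x = y from hl) ▸ hm
  | cons s l ih =>
    obtain ⟨w, hw, h⟩ := hl
    exact ⟨w, hw, ih h⟩

theorem Chain.reverse {l : List E.EssentialAut} {x y : S} (hl : Chain l x y) :
    Chain (l.map inv).reverse y x := by
  induction l generalizing x with
  | nil => exact Eq.symm hl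
  | cons s l ih =>
    obtain ⟨w, hw, h⟩ := hl
    rw [List.map_cons, List.reverse_cons]
    exact (ih h).append ⟨x, hw.inv, rfl⟩

/-- Chains follow single elements, which makes composing and restricting easy. The subgroups `P_i`
are recovered here as the successive images of `P`. -/
theorem exists_sequence (l : List E.EssentialAut) {P P' : ClosedSubgroup S}
    (hP : IsOpen (P : Set S)) {φ : P ≃* P'} (hφ : HomFamily.IsIso E.Hom φ)
    (h : ∀ u : P, Chain l u (φ u)) :
    ∃ (n : ℕ) (R : Fin (n + 1) → ClosedSubgroup S) (s : Fin n → E.EssentialAut),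
      R 0 = P ∧ R (Fin.last n) = P' ∧ (∀ i, IsOpen (R i : Set S)) ∧
      (∀ i : Fin n, R i.castSucc ≤ (s i).domain ∧ R i.succ ≤ (s i).domain ∧
        ∀ y : S, y ∈ R i.succ ↔
          ∃ x : (s i).domain, (x : S) ∈ R i.castSucc ∧ ((s i).aut.1 x : S) = y) ∧
      ∀ u : P, ∃ x : Fin (n + 1) → S, x 0 = u ∧ x (Fin.last n) = φ u ∧
        ∀ i : Fin n, (s i).Rel (x i.castSucc) (x i.succ) := by
  induction l generalizing P with
  | nil =>
    have hu : ∀ u : P, (u : S) = φ u := h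
    have hPP' : P = P' := by
      refine SetLike.ext fun x => ⟨fun hx => ?_, fun hx => ?_⟩
      · have e : x = φ ⟨x, hx⟩ := hu ⟨x, hx⟩
        rw [e]
        exact (φ ⟨x, hx⟩).2
      · have e := hu (φ.symm ⟨x, hx⟩)
        rw [φ.apply_symm_apply] at e
        have e' : x = φ.symm ⟨x, hx⟩ := e.symm
        rw [e']
        exact (φ.symm ⟨x, hx⟩).2
    exact ⟨0, fun _ => P, Fin.elim0, rfl, hPP', fun _ => hP, fun i => i.elim0,
      fun u => ⟨fun _ => u, rfl, hu u, fun i => i.elim0⟩⟩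
  | cons s l ih =>
    have hle : P ≤ s.domain := fun x hx => by
      obtain ⟨w, ⟨hw, -⟩, -⟩ := h ⟨x, hx⟩
      exact hw
    obtain ⟨P₁, hP₁, θ, hθ, hs⟩ := E.factor (E.comp_mem s.aut.2.1 (E.inclHom_mem hle))
    have hsθ : ∀ u : P, (s.aut.1 ⟨u, hle u.2⟩ : S) = θ u := fun u =>
      congrArg Subtype.val (DFunLike.congr_fun hs u)
    obtain ⟨n, R, t, hR0, hRn, hRo, hRt, hx⟩ := ih (P := P₁) (φ := θ.symm.trans φ)
      (E.isOpen_and_index_eq_of_isIso hP hθ).1 (isIso_trans (isIso_symm hθ) hφ) fun v => by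
        obtain ⟨w, ⟨hw, rfl⟩, hc⟩ := h (θ.symm v)
        have e := hsθ (θ.symm v)
        rw [θ.apply_symm_apply] at e
        rw [e] at hc
        exact hc
    refine ⟨n + 1, Fin.cons P R, Fin.cons s t, rfl, ?_, ?_, ?_, ?_⟩
    · rw [← Fin.succ_last, Fin.cons_succ, hRn]
    · exact Fin.cases hP hRo
    · refine Fin.cases ?_ fun i => ?_
      · rw [Fin.castSucc_zero, Fin.cons_zero, Fin.cons_zero, Fin.cons_succ, hR0]
        refine ⟨hle, hP₁, fun y => ⟨fun hy => ?_, ?_⟩⟩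
        · refine ⟨⟨θ.symm ⟨y, hy⟩, hle (θ.symm ⟨y, hy⟩).2⟩, (θ.symm ⟨y, hy⟩).2, ?_⟩
          rw [hsθ, θ.apply_symm_apply]
        · rintro ⟨x, hx, rfl⟩
          have := hsθ ⟨x, hx⟩
          exact this ▸ (θ ⟨x, hx⟩).2
      · rw [← Fin.succ_castSucc, Fin.cons_succ, Fin.cons_succ, Fin.cons_succ]
        exact hRt i
    · intro u
      obtain ⟨x, hx0, hxn, hxi⟩ := hx (θ u)
      refine ⟨Fin.cons (u : S) x, rfl, ?_, Fin.cases ?_ fun i => ?_⟩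
      · rw [← Fin.succ_last, Fin.cons_succ, hxn]
        simp
      · rw [Fin.castSucc_zero, Fin.cons_zero, Fin.cons_zero, Fin.cons_succ, hx0]
        exact ⟨hle u.2, (hsθ u).symm⟩
      · rw [← Fin.succ_castSucc, Fin.cons_succ, Fin.cons_succ, Fin.cons_succ]
        exact hxi i

end EssentialAut

/-- `φ` is a restriction of a composite of automorphisms in `E` of open, `E`-essential and fully
normalized subgroups. -/
def Decomposes {P Q : ClosedSubgroup S} (φ : P ≃* Q) : Prop :=
  ∃ l : List E.EssentialAut, ∀ u : P, EssentialAut.Chain l u (φ u)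

variable {E}

theorem Decomposes.trans {P Q R : ClosedSubgroup S} {φ : P ≃* Q} {ψ : Q ≃* R}
    (hφ : E.Decomposes φ) (hψ : E.Decomposes ψ) : E.Decomposes (φ.trans ψ) := by
  obtain ⟨l, hl⟩ := hφ
  obtain ⟨m, hm⟩ := hψ
  exact ⟨l ++ m, fun u => (hl u).append (hm (φ u))⟩

theorem Decomposes.symm {P Q : ClosedSubgroup S} {φ : P ≃* Q} (hφ : E.Decomposes φ) :
    E.Decomposes φ.symm := by
  obtain ⟨l, hl⟩ := hφ
  refine ⟨(l.map EssentialAut.inv).reverse, fun u => ?_⟩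
  have h := (hl (φ.symm u)).reverse
  rwa [φ.apply_symm_apply] at h

theorem Decomposes.restrict {P Q P' Q' : ClosedSubgroup S} {φ : P ≃* Q} {ψ : P' ≃* Q'}
    (hφ : E.Decomposes φ) (hle : P' ≤ P) (h : ∀ u : P', (φ ⟨u, hle u.2⟩ : S) = ψ u) :
    E.Decomposes ψ := by
  obtain ⟨l, hl⟩ := hφ
  exact ⟨l, fun u => h u ▸ hl ⟨u, hle u.2⟩⟩

theorem Decomposes.of_essential {Q : ClosedSubgroup S} (hQ : IsOpen (Q : Set S))
    (hess : E.Essential Q) (hfn : E.FullyNormalized Q) (γ : E.aut Q) : E.Decomposes γ.1 :=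
  ⟨[⟨Q, γ, hQ, hess, hfn⟩], fun u => ⟨_, ⟨u.2, rfl⟩, rfl⟩⟩

end

end TSubsystem

/-! ### Extending isomorphisms to larger subgroups. -/

theorem IsProP.map {G H : Type*} [Group G] [TopologicalSpace G] [Group H] [TopologicalSpace H]
    {p : ℕ} {X : Subgroup G} (hX : IsProP p X) {f : G →* H} (hf : Continuous f) :
    IsProP p (X.map f) := by
  intro N hN hNo
  obtain ⟨k, hk⟩ := hX (N.comap (f.subgroupMap X)) inferInstance
    (hNo.preimage ((hf.comp continuous_subtype_val).subtype_mk _))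
  exact ⟨k, by rw [← hk, Subgroup.index_comap_of_surjective _ (f.subgroupMap_surjective X)]⟩

namespace TSubsystem

section

variable {p : ℕ} {S : Type u} [Group S] [TopologicalSpace S] [IsTopologicalGroup S]
  [CompactSpace S] [T2Space S] {F : ProFusionSystem.{u, v, w} p S} {T : ClosedSubgroup S}
  {E : TSubsystem F T}

theorem le_extDomain {R Q : ClosedSubgroup S} {φ : R ≃* Q} (hφ : HomFamily.IsIso E.Hom φ) :
    R ≤ E.extDomain φ hφ := fun x hx =>
  ⟨(le_sup_right : R.toSubgroup ≤ _) hx, φ ⟨x, hx⟩,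
    (le_sup_right : Q.toSubgroup ≤ (normMul T Q).toSubgroup) (φ ⟨x, hx⟩).2, fun u => by
      have e : φ (⟨x, hx⟩ * u * ⟨x, hx⟩⁻¹) = φ ⟨x, hx⟩ * φ u * (φ ⟨x, hx⟩)⁻¹ := by
        rw [map_mul, map_mul, map_inv]
      exact congrArg Subtype.val e⟩

theorem mem_normMul {Q : ClosedSubgroup S} {t : S} (ht : t ∈ T)
    (htQ : t ∈ Subgroup.normalizer (Q : Set S)) : t ∈ normMul T Q :=
  (le_sup_left : _ ≤ (normMul T Q).toSubgroup) ⟨ht, htQ⟩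

theorem mem_extDomain_of_mem_centralizer {R Q : ClosedSubgroup S} {φ : R ≃* Q}
    (hφ : HomFamily.IsIso E.Hom φ) {t : S} (ht : t ∈ T)
    (htR : t ∈ Subgroup.centralizer (R : Set S)) : t ∈ E.extDomain φ hφ := by
  have htn := Subgroup.centralizer_le_normalizer (R : Set S) htR
  refine ⟨mem_normMul ht htn, 1, one_mem _, fun u => ?_⟩
  have e : (⟨t * u * t⁻¹, normMul_conj_mem (mem_normMul ht htn) u.2⟩ : R) = u := by
    refine Subtype.ext ?_
    change t * u * t⁻¹ = u
    rw [← Subgroup.mem_centralizer_iff.1 htR u u.2, mul_inv_cancel_right]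
  rw [e]
  simp

/-- The engine of the induction: receptivity extends `φ` to `N^T_φ`, which contains `t` and so has
smaller index than `R`. -/
theorem decomposes_of_mem_extDomain {R Q : ClosedSubgroup S} (hR : IsOpen (R : Set S))
    (ih : ∀ {P P' : ClosedSubgroup S} (θ : P ≃* P'), IsOpen (P : Set S) →
      P.toSubgroup.index < R.toSubgroup.index → HomFamily.IsIso E.Hom θ → E.Decomposes θ)
    (hQ : E.Receptive Q) {φ : R ≃* Q} (hφ : HomFamily.IsIso E.Hom φ) {t : S}
    (ht : t ∈ E.extDomain φ hφ) (htR : t ∉ R) : E.Decomposes φ := by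
  have hle : R ≤ E.extDomain φ hφ := le_extDomain hφ
  obtain ⟨ψ, hψ, h⟩ := hQ R φ hφ
  obtain ⟨R', hR', θ, hθ, rfl⟩ := E.factor hψ
  have : Finite (S ⧸ R.toSubgroup) := R.toSubgroup.quotient_finite_of_isOpen hR
  have hlt : R.toSubgroup < (E.extDomain φ hφ).toSubgroup :=
    lt_of_le_not_ge hle fun hge => htR (hge ht)
  have hfin : R.toSubgroup.FiniteIndex := ⟨Subgroup.index_ne_zero_of_finite⟩
  exact (ih θ (Subgroup.isOpen_mono hlt.le hR) (Subgroup.index_strictAnti hlt) hθ).restrict hle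
    fun u => h ⟨u, hle u.2⟩ u.2

/-- A receptive subgroup that is not centric does not contain its centralizer in `T`. -/
theorem exists_mem_centralizer_notMem {Q : ClosedSubgroup S} (hQ : E.Receptive Q)
    (hcent : ¬ E.Centric Q) : ∃ t ∈ T, t ∈ Subgroup.centralizer (Q : Set S) ∧ t ∉ Q := by
  obtain ⟨Q', ⟨θ, hθ⟩, hQ'⟩ : ∃ Q', E.Isomorphic Q Q' ∧
      ¬ T.toSubgroup ⊓ Subgroup.centralizer (Q' : Set S) ≤
        (Subgroup.center Q'.toSubgroup).map Q'.toSubgroup.subtype := by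
    simpa [Centric] using hcent
  obtain ⟨t, ⟨htT, htc⟩, htn⟩ := SetLike.not_le_iff_exists.1 hQ'
  have htQ' : t ∉ Q' := fun ht => htn ⟨⟨t, ht⟩, Subgroup.mem_center_iff.2 fun g =>
    Subtype.ext (Subgroup.mem_centralizer_iff.1 htc g g.2), rfl⟩
  have hφ := isIso_symm hθ
  -- The extension `ψ` of `θ⁻¹` is defined at `t`, and `ψ(t)` is the required element: it is outside
  -- `Q` because `ψ` is injective and already maps `Q'` onto `Q`.
  obtain ⟨ψ, hψ, h⟩ := hQ Q' θ.symm hφ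
  have hle : Q' ≤ E.extDomain θ.symm hφ := le_extDomain hφ
  let τ : E.extDomain θ.symm hφ := ⟨t, mem_extDomain_of_mem_centralizer hφ htT htc⟩
  have hv : ∀ v : Q, (v : S) = ψ ⟨θ v, hle (θ v).2⟩ := fun v => by
    rw [h ⟨θ v, hle (θ v).2⟩ (θ v).2]
    exact congrArg Subtype.val (θ.symm_apply_apply v).symm
  refine ⟨ψ τ, ?_, ?_, fun hmem => htQ' ?_⟩
  · simpa using mul_mem (E.mul_inv_mem hψ τ) (show (τ : S) ∈ T from htT)
  · refine Subgroup.mem_centralizer_iff.2 fun v hvQ => ?_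
    have e := hv ⟨v, hvQ⟩
    have hc : (⟨θ ⟨v, hvQ⟩, hle (θ ⟨v, hvQ⟩).2⟩ : E.extDomain θ.symm hφ) * τ =
        τ * ⟨θ ⟨v, hvQ⟩, hle (θ ⟨v, hvQ⟩).2⟩ :=
      Subtype.ext (Subgroup.mem_centralizer_iff.1 htc _ (θ ⟨v, hvQ⟩).2)
    have h2 := congrArg (fun z => ((ψ z : normMul T Q) : S)) hc
    simp only [map_mul] at h2
    change v = _ at e
    rw [e]
    exact h2
  · have e : ψ τ = ψ ⟨θ ⟨_, hmem⟩, hle (θ ⟨_, hmem⟩).2⟩ := Subtype.ext (hv ⟨_, hmem⟩)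
    have e' := congrArg Subtype.val (ProFusionSystem.injective_of_mem (E.subset _ _ hψ) e)
    change t = θ ⟨_, hmem⟩ at e'
    rw [e']
    exact (θ ⟨_, hmem⟩).2

theorem conj_pow_apply {Q : ClosedSubgroup S} {α : MulAut Q} {t : S}
    (h : ∀ x : Q, (α x : S) = t * x * t⁻¹) (n : ℕ) (x : Q) :
    ((α ^ n) x : S) = t ^ n * x * (t ^ n)⁻¹ := by
  induction n with
  | zero => simp
  | succ n ih => rw [pow_succ', pow_succ', MulAut.mul_apply, h, ih]; group

/-- Some power `t ^ p ^ k` dies in the finite `p`-group `S_i`, so conjugation by it is trivial on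
`f_i(R)`; transport by `χ` respects this. -/
theorem exists_pow_mem_autKer {R Q : ClosedSubgroup S} {χ : R ≃* Q}
    (hχ : HomFamily.IsIso E.Hom χ) {X : Subgroup S} {c : MulAut R} (hc : c ∈ conjAut X R)
    {y : E.aut Q} (hy : y.1 = MulAut.congr χ c) (i : F.sys.I) :
    ∃ k : ℕ, y ^ p ^ k ∈ E.autKer Q i := by
  obtain ⟨t, -, ht⟩ := hc
  obtain ⟨k, hk⟩ := F.exists_pow_proj_eq_one i t
  refine ⟨k, fun v => ?_⟩
  have e : (y ^ p ^ k).1 v = χ ((c ^ p ^ k) (χ.symm v)) := by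
    rw [Subgroup.coe_pow, hy, ← map_pow]
    rfl
  rw [e]
  have h := ProFusionSystem.proj_congr (E.subset _ _ hχ.1) (i := i)
    (x := (c ^ p ^ k) (χ.symm v)) (y := χ.symm v) (by rw [conj_pow_apply ht]; simp [hk])
  refine h.trans (congrArg (fun z : Q => F.proj i z) (χ.apply_symm_apply v))

theorem exists_pow_mem_autKer_of_mem_innerAut {Q : ClosedSubgroup S} {X : Subgroup S}
    {y : E.aut Q} (hy : y ∈ E.innerAut X Q) (i : F.sys.I) :
    ∃ k : ℕ, y ^ p ^ k ∈ E.autKer Q i :=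
  exists_pow_mem_autKer (χ := MulEquiv.refl Q) ⟨E.id_mem Q, E.id_mem Q⟩ hy rfl i

/-- Links Sylow's theorem to receptivity: the condition defining `N^T_φ` holds at `t` once `φ c_t
φ⁻¹` lies in `Aut_T(Q)`. -/
theorem mem_extDomain_of_conj {R Q : ClosedSubgroup S} {φ : R ≃* Q}
    (hφ : HomFamily.IsIso E.Hom φ) {t : S} (ht : t ∈ T)
    (htR : t ∈ Subgroup.normalizer (R : Set S)) {c : MulAut R}
    (hc : ∀ x : R, (c x : S) = t * x * t⁻¹)
    (h : MulAut.congr φ c ∈ conjAut T.toSubgroup Q) : t ∈ E.extDomain φ hφ := by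
  obtain ⟨s, ⟨hs, hsQ⟩, hsc⟩ := h
  refine ⟨mem_normMul ht htR, s, mem_normMul hs hsQ, fun u => ?_⟩
  have e : (⟨t * u * t⁻¹, normMul_conj_mem (mem_normMul ht htR) u.2⟩ : R) =
      c (φ.symm (φ u)) := Subtype.ext (by rw [φ.symm_apply_apply]; exact (hc u).symm)
  rw [e]
  exact hsc (φ u)

theorem innerAut_le {Q : ClosedSubgroup S} :
    E.innerAut (T.toSubgroup ⊓ Q.toSubgroup) Q ≤ E.innerAut T.toSubgroup Q := by
  rintro α ⟨t, ⟨⟨ht, -⟩, htn⟩, h⟩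
  exact ⟨t, ⟨ht, htn⟩, h⟩

/-- An automorphism of a receptive subgroup `Q` that conjugates some element of `Aut_T(Q)` outside
`Aut_{T ∩ Q}(Q)` into `Aut_T(Q)` extends to a larger subgroup. -/
theorem decomposes_of_conj_mem {Q : ClosedSubgroup S} (hQo : IsOpen (Q : Set S))
    (ih : ∀ {P P' : ClosedSubgroup S} (θ : P ≃* P'), IsOpen (P : Set S) →
      P.toSubgroup.index < Q.toSubgroup.index → HomFamily.IsIso E.Hom θ → E.Decomposes θ)
    (hQ : E.Receptive Q) {x γ : E.aut Q} (hx : x ∈ E.innerAut T.toSubgroup Q)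
    (hxn : x ∉ E.innerAut (T.toSubgroup ⊓ Q.toSubgroup) Q)
    (hγ : γ * x * γ⁻¹ ∈ E.innerAut T.toSubgroup Q) : E.Decomposes γ.1 := by
  obtain ⟨t, ⟨ht, htQ⟩, htx⟩ := hx
  exact decomposes_of_mem_extDomain hQo ih hQ γ.2 (mem_extDomain_of_conj γ.2 ht htQ htx hγ)
    fun h => hxn ⟨t, ⟨⟨ht, h⟩, htQ⟩, htx⟩

/-! ### The poset of `p`-subgroups of `Aut_E(Q) / Aut_{T ∩ Q}(Q)`. -/

section Quotient

variable (E) in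
/-- The preimage in `Aut_E(Q)` of a subgroup of `Aut_E(Q) / Aut_{T ∩ Q}(Q)`. -/
def preimage (Q : ClosedSubgroup S)
    (a : Subgroup (E.aut Q ⧸ E.innerAut (T.toSubgroup ⊓ Q.toSubgroup) Q)) :
    Subgroup (E.aut Q) :=
  a.comap (QuotientGroup.mk' _)

variable {Q : ClosedSubgroup S}

theorem exists_pow_mem_autKer_of_isProP
    {a : Subgroup (E.aut Q ⧸ E.innerAut (T.toSubgroup ⊓ Q.toSubgroup) Q)} (ha : IsProP p a)
    {y : E.aut Q} (hy : y ∈ E.preimage Q a) (i : F.sys.I) :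
    ∃ k : ℕ, y ^ p ^ k ∈ E.autKer Q i := by
  let q := QuotientGroup.mk' (E.innerAut (T.toSubgroup ⊓ Q.toSubgroup) Q)
  have hN : ((E.autKer Q i).map q).Normal :=
    Subgroup.Normal.map inferInstance q (QuotientGroup.mk'_surjective _)
  obtain ⟨k, hk⟩ := ha (((E.autKer Q i).map q).subgroupOf a) inferInstance
    ((QuotientGroup.isOpenMap_coe _ (E.isOpen_autKer Q i)).preimage continuous_subtype_val)
  have hpow := Subgroup.pow_index_mem (((E.autKer Q i).map q).subgroupOf a) ⟨q y, hy⟩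
  rw [hk] at hpow
  obtain ⟨n, hn, hny⟩ : ∃ n ∈ E.autKer Q i, q n = q y ^ p ^ k := hpow
  rw [← map_pow] at hny
  obtain ⟨m, hm⟩ := exists_pow_mem_autKer_of_mem_innerAut (QuotientGroup.eq.1 hny) i
  -- The exponent `k` brings `y` into `autKer` times `Aut_{T ∩ Q}(Q)`, and `m` then removes the
  -- second factor.
  refine ⟨k + m, ?_⟩
  rw [← QuotientGroup.eq_one_iff] at hn hm ⊢
  rw [QuotientGroup.mk_pow, QuotientGroup.mk_mul, QuotientGroup.mk_inv, hn, inv_one, one_mul,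
    ← QuotientGroup.mk_pow, ← pow_mul, ← pow_add] at hm
  exact hm

theorem mk_mem_map_conj_iff {γ y : E.aut Q} :
    (y : E.aut Q ⧸ E.innerAut (T.toSubgroup ⊓ Q.toSubgroup) Q) ∈
      (E.innerAut T.toSubgroup Q).map ((QuotientGroup.mk' _).comp (MulAut.conj γ).toMonoidHom) ↔
    γ⁻¹ * y * γ ∈ E.innerAut T.toSubgroup Q := by
  constructor
  · rintro ⟨x, hx, h⟩
    have hxy : ((γ * x * γ⁻¹ : E.aut Q) :
      E.aut Q ⧸ E.innerAut (T.toSubgroup ⊓ Q.toSubgroup) Q) = y := h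
    rw [QuotientGroup.eq] at hxy
    have h2 := mul_mem hx (innerAut_le ((E.innerAut_normal Q).conj_mem _ hxy γ⁻¹))
    simpa [mul_assoc] using h2
  · intro h
    exact ⟨_, h, by simp [mul_assoc]⟩

/-- The image in `Aut_E(Q) / Aut_{T ∩ Q}(Q)` of the conjugate of `Aut_T(Q)` by `γ`. -/
def conjSylow (hQ : IsSylowProP p (E.innerAut T.toSubgroup Q))
    (hne : ∃ x ∈ E.innerAut T.toSubgroup Q, x ∉ E.innerAut (T.toSubgroup ⊓ Q.toSubgroup) Q)
    (γ : E.aut Q) :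
    SpPoset p (E.aut Q ⧸ E.innerAut (T.toSubgroup ⊓ Q.toSubgroup) Q) :=
  ⟨(E.innerAut T.toSubgroup Q).map ((QuotientGroup.mk' _).comp (MulAut.conj γ).toMonoidHom), by
    -- The preimage is the conjugate of `Aut_T(Q)` by `γ` itself, as that conjugate contains the
    -- normal subgroup `Aut_{T ∩ Q}(Q)`.
    rw [← isQuotientMap_quotient_mk'.isClosed_preimage]
    have h : IsClosed {y : E.aut Q | γ⁻¹ * y * γ ∈ E.innerAut T.toSubgroup Q} :=
      hQ.1.preimage (by fun_prop)
    convert h using 1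
    ext y
    exact mk_mem_map_conj_iff, hQ.2.1.map (by
      exact continuous_quotient_mk'.comp
        (show Continuous fun x : E.aut Q => γ * x * γ⁻¹ by fun_prop)), fun h => by
    obtain ⟨x, hx, hxn⟩ := hne
    have h1 := Subgroup.mem_map_of_mem
      ((QuotientGroup.mk' (E.innerAut (T.toSubgroup ⊓ Q.toSubgroup) Q)).comp
        (MulAut.conj γ).toMonoidHom) hx
    rw [h, Subgroup.mem_bot] at h1
    have h2 := (E.innerAut_normal Q).conj_mem _ ((QuotientGroup.eq_one_iff (γ * x * γ⁻¹)).1 h1) γ⁻¹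
    exact hxn (by simpa [mul_assoc] using h2)⟩

/-- If `S_p(Aut_E(Q) / Aut_{T ∩ Q}(Q))` is connected, then the automorphisms of `Q` decompose. -/
theorem decomposes_of_posetConnected [Fact p.Prime] (hQo : IsOpen (Q : Set S))
    (ih : ∀ {P P' : ClosedSubgroup S} (θ : P ≃* P'), IsOpen (P : Set S) →
      P.toSubgroup.index < Q.toSubgroup.index → HomFamily.IsIso E.Hom θ → E.Decomposes θ)
    (hQ : E.FullyNormalized Q)
    (hconn : PosetConnected (SpPoset p (E.aut Q ⧸ E.innerAut (T.toSubgroup ⊓ Q.toSubgroup) Q)))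
    (γ : E.aut Q) : E.Decomposes γ.1 := by
  have hconj : ∀ a : SpPoset p (E.aut Q ⧸ E.innerAut (T.toSubgroup ⊓ Q.toSubgroup) Q),
      ∃ g : E.aut Q, ∀ y ∈ E.preimage Q a.1, g⁻¹ * y * g ∈ E.innerAut T.toSubgroup Q := fun a =>
    E.exists_conj_mem_of_isSylowProP hQ.2 fun _ hy =>
      exists_pow_mem_autKer_of_isProP a.2.2.1 hy
  have hnt : ∀ a : SpPoset p (E.aut Q ⧸ E.innerAut (T.toSubgroup ⊓ Q.toSubgroup) Q),
      ∃ y ∈ E.preimage Q a.1, y ∉ E.innerAut (T.toSubgroup ⊓ Q.toSubgroup) Q := by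
    intro a
    obtain ⟨z, hz1⟩ := a.1.ne_bot_iff_exists_ne_one.1 a.2.2.2
    obtain ⟨y, hy⟩ := QuotientGroup.mk_surjective z.1
    refine ⟨y, show (y : E.aut Q ⧸ _) ∈ a.1 from hy ▸ z.2, fun h => hz1 (Subtype.ext ?_)⟩
    rw [← hy]
    exact (QuotientGroup.eq_one_iff y).2 h
  have hmul : ∀ α β : E.aut Q, E.Decomposes α.1 → E.Decomposes β.1 → E.Decomposes (α * β).1 :=
    fun α β hα hβ => hβ.trans hα
  have hinv : ∀ α : E.aut Q, E.Decomposes α.1 → E.Decomposes (α⁻¹).1 := fun α hα => hα.symm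
  have hle : ∀ a b : SpPoset p (E.aut Q ⧸ E.innerAut (T.toSubgroup ⊓ Q.toSubgroup) Q), a ≤ b →
      ∀ g h : E.aut Q, (∀ y ∈ E.preimage Q a.1, g⁻¹ * y * g ∈ E.innerAut T.toSubgroup Q) →
      (∀ y ∈ E.preimage Q b.1, h⁻¹ * y * h ∈ E.innerAut T.toSubgroup Q) →
      E.Decomposes (g⁻¹ * h).1 := by
    intro a b hab g h hg hh
    obtain ⟨y, hy, hyn⟩ := hnt a
    -- Conjugation by `h⁻¹g` takes `g⁻¹yg` to `h⁻¹yh`, and both lie in `Aut_T(Q)`.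
    have hd := decomposes_of_conj_mem (γ := (g⁻¹ * h)⁻¹) hQo ih hQ.1 (hg y hy)
      (fun hmem => hyn ?_) ?_
    · have := hinv _ hd
      rwa [inv_inv] at this
    · have := (E.innerAut_normal Q).conj_mem _ hmem g
      simpa [mul_assoc] using this
    · have := hh y (hab hy)
      simpa [mul_assoc] using this
  have hgen : ∀ a b : SpPoset p (E.aut Q ⧸ E.innerAut (T.toSubgroup ⊓ Q.toSubgroup) Q),
      Relation.EqvGen (· ≤ ·) a b →
      ∀ g h : E.aut Q, (∀ y ∈ E.preimage Q a.1, g⁻¹ * y * g ∈ E.innerAut T.toSubgroup Q) →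
      (∀ y ∈ E.preimage Q b.1, h⁻¹ * y * h ∈ E.innerAut T.toSubgroup Q) →
      E.Decomposes (g⁻¹ * h).1 := by
    intro a b hab
    induction hab with
    | rel a b h => exact hle a b h
    | refl a => exact hle a a le_rfl
    | symm a b _ IH =>
      intro g h hg hh
      have := hinv _ (IH h g hh hg)
      rwa [mul_inv_rev, inv_inv] at this
    | trans a b c _ _ IH1 IH2 =>
      intro g h hg hh
      obtain ⟨k, hk⟩ := hconj b
      have := hmul _ _ (IH1 g k hg hk) (IH2 k h hk hh)
      simpa [mul_assoc] using this
  -- Connectedness includes non-emptiness: a non-trivial `p`-subgroup of the quotient, conjugated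
  -- into the image of `Aut_T(Q)`, shows that this image is non-trivial.
  have hne : ∃ x ∈ E.innerAut T.toSubgroup Q,
      x ∉ E.innerAut (T.toSubgroup ⊓ Q.toSubgroup) Q := by
    obtain ⟨a⟩ := hconn.1
    obtain ⟨g, hg⟩ := hconj a
    obtain ⟨y, hy, hyn⟩ := hnt a
    refine ⟨_, hg y hy, fun hmem => hyn ?_⟩
    have := (E.innerAut_normal Q).conj_mem _ hmem g
    simpa [mul_assoc] using this
  -- The end points of the path are conjugated into `Aut_T(Q)` by `1` and `γ`, so the product along
  -- it is `1⁻¹γ`.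
  have := hgen _ _ (hconn.2 (conjSylow hQ.2 hne 1) (conjSylow hQ.2 hne γ)) 1 γ
    (fun y hy => mk_mem_map_conj_iff.1 hy)
    (fun y hy => mk_mem_map_conj_iff.1 hy)
  rwa [inv_one, one_mul] at this

end Quotient

/-! ### The induction on the index. -/

theorem decomposes_aut [Fact p.Prime] {Q : ClosedSubgroup S} (hQo : IsOpen (Q : Set S))
    (ih : ∀ {P P' : ClosedSubgroup S} (θ : P ≃* P'), IsOpen (P : Set S) →
      P.toSubgroup.index < Q.toSubgroup.index → HomFamily.IsIso E.Hom θ → E.Decomposes θ)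
    (hQ : E.FullyNormalized Q) (γ : E.aut Q) : E.Decomposes γ.1 := by
  by_cases hess : E.Essential Q
  · exact Decomposes.of_essential hQo hess hQ γ
  · obtain ⟨-, h⟩ := not_or.1 hess
    by_cases hcent : E.Centric Q
    · exact decomposes_of_posetConnected hQo ih hQ (by_contra fun hc => h ⟨hcent, hc⟩) γ
    · obtain ⟨t, ht, htc, htQ⟩ := exists_mem_centralizer_notMem hQ.1 hcent
      exact decomposes_of_mem_extDomain hQo ih hQ.1 γ.2
        (mem_extDomain_of_mem_centralizer γ.2 ht htc) htQ

theorem decomposes_to_fullyNormalized [Fact p.Prime] (hT : F.StronglyClosed T)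
    {R Q : ClosedSubgroup S} (hRo : IsOpen (R : Set S))
    (ih : ∀ {P P' : ClosedSubgroup S} (θ : P ≃* P'), IsOpen (P : Set S) →
      P.toSubgroup.index < R.toSubgroup.index → HomFamily.IsIso E.Hom θ → E.Decomposes θ)
    (hQ : E.FullyNormalized Q) {χ : R ≃* Q} (hχ : HomFamily.IsIso E.Hom χ) :
    E.Decomposes χ := by
  obtain ⟨hQo, hidx⟩ := E.isOpen_and_index_eq_of_isIso hRo hχ
  have haut := decomposes_aut hQo (fun {_ _} θ h h' => ih θ h (hidx ▸ h')) hQ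
  by_cases hTR : T ≤ R
  -- `χ⁻¹` changes `y` only by a factor in `T ≤ R`. Then `χ` followed by `Q ≤ R` is an endomorphism
  -- of `R`, hence onto, and `Q = R`.
  · have hQR : Q ≤ R := fun y hy => by
      have h := hTR (E.mul_inv_mem hχ.2 ⟨y, hy⟩)
      have h2 := R.toSubgroup.mul_mem (R.toSubgroup.inv_mem h) (χ.symm ⟨y, hy⟩).2
      have h3 : y ∈ R.toSubgroup := by simpa using h2
      exact h3
    have hRQ : R ≤ Q := fun x hx => by
      obtain ⟨z, hz⟩ := ProFusionSystem.surjective_of_mem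
        (E.subset _ _ (E.comp_mem (E.inclHom_mem hQR) hχ.1)) ⟨x, hx⟩
      have : (χ z : S) = x := congrArg Subtype.val hz
      rw [← this]
      exact (χ z).2
    obtain rfl := le_antisymm hQR hRQ
    exact haut ⟨χ, hχ⟩
  · obtain ⟨t, ht, htn, htR⟩ := exists_mem_normalizer_notMem hT hRo hTR
    let Y : Subgroup (E.aut Q) :=
      ((conjAut T.toSubgroup R).map (MulAut.congr χ).toMonoidHom).subgroupOf (E.aut Q)
    obtain ⟨g, hg⟩ := E.exists_conj_mem_of_isSylowProP (Y := Y) hQ.2 (by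
      rintro y ⟨c, hc, hcy⟩ i
      exact exists_pow_mem_autKer hχ hc hcy.symm i)
    let c : MulAut R := R.toSubgroup.normalizerMonoidHom ⟨t, htn⟩
    have hct : ∀ x : R, (c x : S) = t * x * t⁻¹ := fun _ => rfl
    have hc : c ∈ conjAut T.toSubgroup R := ⟨t, ⟨ht, htn⟩, hct⟩
    have hcE := E.conjAut_le_aut R hc
    have hy := hg ⟨MulAut.congr χ c, isIso_trans (isIso_symm hχ) (isIso_trans hcE hχ)⟩
      ⟨c, hc, rfl⟩
    -- The twist by `g⁻¹` puts `t ∉ R` into the domain of extension; `g` is restored afterwards as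
    -- an automorphism of `Q`.
    have hφ : HomFamily.IsIso E.Hom (χ.trans (g⁻¹).1) := isIso_trans hχ (g⁻¹).2
    have hd := (decomposes_of_mem_extDomain hRo ih hQ.1 hφ
      (mem_extDomain_of_conj hφ ht htn hct hy) htR).trans (haut g)
    exact hd.restrict le_rfl fun u => congrArg Subtype.val (MulAut.apply_inv_self _ g.1 (χ u))

theorem decomposes_of_saturated [Fact p.Prime] (hT : F.StronglyClosed T) (hE : E.Saturated)
    {P P' : ClosedSubgroup S} (hP : IsOpen (P : Set S)) {φ : P ≃* P'}
    (hφ : HomFamily.IsIso E.Hom φ) : E.Decomposes φ := by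
  induction hn : P.toSubgroup.index using Nat.strong_induction_on generalizing P P' with
  | h n ih =>
    obtain ⟨Q, ⟨χ, hχ⟩, hQ⟩ := hE P
    obtain ⟨hP', hidx⟩ := E.isOpen_and_index_eq_of_isIso hP hφ
    have ih' : ∀ {R R' : ClosedSubgroup S} (θ : R ≃* R'), IsOpen (R : Set S) →
        R.toSubgroup.index < n → HomFamily.IsIso E.Hom θ → E.Decomposes θ :=
      fun {_ _} _ hR hlt hθ => ih _ hlt hR hθ rfl
    have h1 := decomposes_to_fullyNormalized hT hP (hn ▸ ih') hQ hχ
    have h2 := decomposes_to_fullyNormalized hT hP' (hidx ▸ hn ▸ ih') hQ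
      (isIso_trans (isIso_symm hφ) hχ)
    refine (h1.trans h2.symm).restrict le_rfl fun u => ?_
    simp

end

end TSubsystem

/-- The composite `φ_n ⋯ φ_1` is evaluated at `u ∈ P` through the sequence
`x_0 = u`, `x_i = φ_i(x_{i-1})`, in which `x_{i-1} ∈ P_{i-1} ≤ Q_i`. -/
theorem mainTheorem1 {p : ℕ} [Fact p.Prime] {S : Type u} [Group S] [TopologicalSpace S]
    [IsTopologicalGroup S] [CompactSpace S] [T2Space S]
    (F : ProFusionSystem.{u, v, w} p S) (T : ClosedSubgroup S) (hT : F.StronglyClosed T)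
    (E : TSubsystem F T) (hE : E.Saturated)
    (P P' : ClosedSubgroup S) (hP : IsOpen (P : Set S)) (hP' : IsOpen (P' : Set S))
    (φ : P ≃* P') (hφ : HomFamily.IsIso E.Hom φ) :
    ∃ (n : ℕ) (R : Fin (n + 1) → ClosedSubgroup S) (Q : Fin n → ClosedSubgroup S)
      (ψ : ∀ i : Fin n, E.aut (Q i)),
      R 0 = P ∧ R (Fin.last n) = P' ∧
      (∀ i, IsOpen (R i : Set S)) ∧ (∀ i, IsOpen (Q i : Set S)) ∧
      (∀ i, E.Essential (Q i) ∧ E.FullyNormalized (Q i)) ∧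
      (∀ i : Fin n, R i.castSucc ≤ Q i ∧ R i.succ ≤ Q i ∧
        ∀ y : S, y ∈ R i.succ ↔ ∃ x : Q i, (x : S) ∈ R i.castSucc ∧ ((ψ i).1 x : S) = y) ∧
      ∀ u : P, ∃ x : Fin (n + 1) → S, x 0 = u ∧ x (Fin.last n) = φ u ∧
        ∀ i : Fin n, ∃ hx : x i.castSucc ∈ Q i, x i.succ = (ψ i).1 ⟨x i.castSucc, hx⟩ := by
  obtain ⟨l, hl⟩ := TSubsystem.decomposes_of_saturated hT hE hP hφ
  obtain ⟨n, R, s, hR0, hRn, hRo, hs, hx⟩ := TSubsystem.EssentialAut.exists_sequence l hP hφ hl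
  exact ⟨n, R, fun i => (s i).domain, fun i => (s i).aut, hR0, hRn, hRo, fun i => (s i).isOpen,
    fun i => ⟨(s i).essential, (s i).fullyNormalized⟩, hs, hx⟩
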